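/- Let $(\mathbf Z_i,\mathbf X_i)_{i\ge 1}$, with $\mathbf Z_i\in\mathbb R^p$ and $\mathbf X_i=(X_{i,1},X_{i,2})\in\mathbb R^2$, be i.i.d. Let $\mathbf Z_i$ have a density $f_{\mathbf Z}$ on $\mathbb R^p$ and take its values almost surely in a (measurable) set $\mathcal Z\subset\mathbb R^p$. Fix a regular version of the conditional law of $\mathbf X$ given $\mathbf Z=\mathbf z$, absolutely continuous with respect to Lebesgue measure for every $\mathbf z\in\mathcal Z$; all conditional probabilities and expectations below are computed from it. Let $W_{(i,j)}=2\cdot\mathbf 1\{(X_{j,1}-X_{i,1})(X_{j,2}-X_{i,2})>0\}-1$ and $$\tau_{1,2|\mathbf Z=\mathbf z}=\mathbb P\big((X_{2,1}-X_{1,1})(X_{2,2}-X_{1,2})>0\,|\,\mathbf Z_1=\mathbf Z_2=\mathbf z\big)-\mathbb P\big((X_{2,1}-X_{1,1})(X_{2,2}-X_{1,2})<0\,|\,\mathbf Z_1=\mathbf Z_2=\mathbf z\big).$$ Assume the single-index model $\tau_{1,2|\mathbf Z=\mathbf z}=g(\psi(\mathbf z)^T\beta^*)$ for all $\mathbf z\in\mathcal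 Z$, with $g:\mathbb R\to(-1,1)$, $\psi:\mathbb R^p\to\mathbb R^{p'}$ and $\beta^*\in\mathbb R^{p'}$. Put $$q(\mathbf x,\beta)=\tfrac12+\tfrac12 g(\psi(\mathbf x)^T\beta),\qquad \ell_\beta(w,\mathbf z)=\tfrac{1+w}2\log q(\mathbf z,\beta)+\tfrac{1-w}2\log(1-q(\mathbf z,\beta)),$$ $$p(\mathbf x,\mathbf y)=\mathbb P(W_{(1,2)}=1|\mathbf Z_1=\mathbf x,\mathbf Z_2=\mathbf y),\quad p(\mathbf x,\mathbf y,\mathbf z)=\mathbb P(W_{(1,2)}=W_{(1,3)}=1|\mathbf Z_1=\mathbf x,\mathbf Z_2=\mathbf y,\mathbf Z_3=\mathbf z),$$ $$\phi(\mathbf x,\mathbf y,\beta)=p(\mathbf x,\mathbf y)\log q(\mathbf x,\beta)+(1-p(\mathbf x,\mathbf y))\log(1-q(\mathbf x,\beta)).$$ Let $K$ be a compactly supported, square-integrable kernel on $\mathbb R^p$ of order $m\ge2$ ($\int K=1$ and the moments of total degree $1,\dots,m-1$ vanish), $K_h(\mathbf z)=K(\mathbf z/h)/h^p$, $h=h_n>0$,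 $h_n\to0$, $\lambda_n\ge0$, and $$L_n(\beta)=\frac1{n(n-1)}\sum_{1\le i\ne j\le n}K_h(\mathbf Z_i-\mathbf Z_j)\,\ell_\beta(W_{(i,j)},\mathbf Z_i),\qquad \hat\beta_n\in\arg\max_{\beta\in\mathbb R^{p'}}\{L_n(\beta)-\lambda_n|\beta|_1\},$$ where $\hat\beta_n$ is any maximizer whenever one exists, and is arbitrary otherwise. Regularity (R0): $f_{\mathbf Z}$ is $m$ times continuously differentiable on $\mathbb R^p$; for all $\mathbf x\in\mathcal Z$ and all $\beta$, the functions $\phi(\mathbf x,\cdot,\beta)$ and $q(\cdot,\beta)$ are continuous on $\mathcal Z$; and $(\mathbf x,\mathbf y,\mathbf z)\mapsto p(\mathbf x,\mathbf y,\mathbf z)$ is continuous on $\mathcal Z^3$. Integrability: for $\varepsilon>0$ write $F_\varepsilon(x)=\sup_{|x-t|<\varepsilon}|F(t)|$, the arguments $t$ that stand for values of $\mathbf Z$ in $\phi,A,\dots,F$ below ranging over $\mathcal Z$. Let $A,B,C,D$ (at $(\mathbf x,\mathbf y,\mathbf z)$) and $E,F$ (at $(\mathbf x,\mathbf y)$)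 be the conditional expectations, given $\mathbf Z_1=\mathbf x,\mathbf Z_2=\mathbf y,\mathbf Z_3=\mathbf z$, respectively given $\mathbf Z_1=\mathbf x,\mathbf Z_2=\mathbf y$, of the product of $\ell_\beta(W_{(1,2)},\mathbf Z_1)$ with, respectively, $\ell_\beta(W_{(1,3)},\mathbf Z_1)$, $\ell_\beta(W_{(3,1)},\mathbf Z_3)$, $\ell_\beta(W_{(3,2)},\mathbf Z_3)$, $\ell_\beta(W_{(2,3)},\mathbf Z_2)$, and $\ell_\beta(W_{(1,2)},\mathbf Z_1)$, $\ell_\beta(W_{(2,1)},\mathbf Z_2)$. Assume that for every $\beta$ there is $\varepsilon>0$ with $$\int\big(A(\mathbf z,\cdot,\cdot)_\varepsilon(\mathbf z,\mathbf z)+B(\mathbf z,\cdot,\cdot)_\varepsilon(\mathbf z,\mathbf z)+C(\cdot,\mathbf z,\cdot)_\varepsilon(\mathbf z,\mathbf z)+D(\cdot,\mathbf z,\cdot)_\varepsilon(\mathbf z,\mathbf z)\big)f_{\mathbf Z,\varepsilon}^2(\mathbf z)f_{\mathbf Z}(\mathbf z)\,d\mathbf z<\infty,$$ $$\int\big(\phi(\mathbf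 z,\cdot,\beta)_\varepsilon(\mathbf z)+E(\mathbf z,\cdot)_\varepsilon(\mathbf z)+F(\mathbf z,\cdot)_\varepsilon(\mathbf z)\big)f_{\mathbf Z,\varepsilon}(\mathbf z)f_{\mathbf Z}(\mathbf z)\,d\mathbf z<\infty.$$ Assume moreover that $\beta\mapsto L_n(\beta)$ is almost surely concave for every $n$, that $\lambda_n\to\lambda_\infty$ and $n^2h_n^p\to\infty$, and that $\beta\mapsto L_\infty(\beta)-\lambda_\infty|\beta|_1$ has a unique maximizer $\beta^{**}$, where $L_\infty(\beta)=\int\phi(\mathbf z,\mathbf z,\beta)f_{\mathbf Z}(\mathbf z)^2\,d\mathbf z$. Then the integral defining $L_\infty(\beta)$ converges absolutely for every $\beta$, and $\hat\beta_n\to\beta^{**}$ in probability. If $\lambda_\infty=0$, then $\beta^{**}=\beta^*$. -/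

import Mathlib

open MeasureTheory ProbabilityTheory Filter Topology
open scoped ENNReal

noncomputable section

namespace CKT

/-- `ℝ^d` with its Euclidean norm and Lebesgue measure. -/
abbrev Vec (d : ℕ) : Type := EuclideanSpace ℝ (Fin d)

/-- The `ℓ¹` norm on `ℝ^d`. -/
def l1 {d : ℕ} (b : Vec d) : ℝ := ∑ k, |b k|

/-- `K` is a compactly supported (square integrable) kernel on `ℝ^p` of order `m`: it integrates to
one and all its moments of total degree `1, …, m - 1` vanish. -/
structure IsKernelOfOrder {p : ℕ} (K : Vec p → ℝ) (m : ℕ) : Prop where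
  measurable : Measurable K
  compactSupport : HasCompactSupport K
  sq_integrable : Integrable (fun t => K t ^ 2)
  integral_eq_one : ∫ t, K t = 1
  moments : ∀ a : Fin p → ℕ, 1 ≤ ∑ i, a i → ∑ i, a i < m →
    ∫ t, (∏ i, t i ^ a i) * K t = 0

/-- The rescaled kernel `K_h(z) = K(z/h)/h^p`. -/
def scaled {p : ℕ} (K : Vec p → ℝ) (h : ℝ) (z : Vec p) : ℝ := K (h⁻¹ • z) / h ^ p

/-- The pair of observations `x, y` of the bivariate variable is concordant. -/
def Concordant (x y : ℝ × ℝ) : Prop := 0 < (y.1 - x.1) * (y.2 - x.2)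

/-- The pair of observations `x, y` of the bivariate variable is strictly discordant. -/
def Discordant (x y : ℝ × ℝ) : Prop := (y.1 - x.1) * (y.2 - x.2) < 0

open Classical in
/-- The sign `W = 2 · 1{concordant} - 1` of a pair. -/
def W (x y : ℝ × ℝ) : ℝ := 2 * (if Concordant x y then 1 else 0) - 1

section CondLaw

variable {p d : ℕ}

/-! In this section `κ z` is the conditional law of the bivariate variable `X` given `Z = z`, so that,
for independent copies, the conditional law of `(X₁, X₂)` given `Z₁ = x, Z₂ = y` is `κ x ⊗ κ y`, and
similarly for three copies. -/

/-- `E[F(X₁, X₂) | Z₁ = x, Z₂ = y]`. -/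
def condE2 (κ : Kernel (Vec p) (ℝ × ℝ)) (x y : Vec p) (F : ℝ × ℝ → ℝ × ℝ → ℝ) : ℝ :=
  ∫ u, F u.1 u.2 ∂((κ x).prod (κ y))

/-- `E[F(X₁, X₂, X₃) | Z₁ = x, Z₂ = y, Z₃ = z]`. -/
def condE3 (κ : Kernel (Vec p) (ℝ × ℝ)) (x y z : Vec p)
    (F : ℝ × ℝ → ℝ × ℝ → ℝ × ℝ → ℝ) : ℝ :=
  ∫ u, F u.1 u.2.1 u.2.2 ∂((κ x).prod ((κ y).prod (κ z)))

/-- Conditional Kendall's tau given `Z = z`. -/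
def condTau (κ : Kernel (Vec p) (ℝ × ℝ)) (z : Vec p) : ℝ :=
  ((κ z).prod (κ z)).real {u | Concordant u.1 u.2} -
    ((κ z).prod (κ z)).real {u | Discordant u.1 u.2}

/-- `p(x, y)`: probability that the first two observations are concordant, given
`Z₁ = x, Z₂ = y`. -/
def prob2 (κ : Kernel (Vec p) (ℝ × ℝ)) (x y : Vec p) : ℝ :=
  ((κ x).prod (κ y)).real {u | Concordant u.1 u.2}

/-- `p(x, y, z)`: probability that the pairs `(1, 2)` and `(1, 3)` are both concordant, given
`Z₁ = x, Z₂ = y, Z₃ = z`. -/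
def prob3 (κ : Kernel (Vec p) (ℝ × ℝ)) (x y z : Vec p) : ℝ :=
  ((κ x).prod ((κ y).prod (κ z))).real {u | Concordant u.1 u.2.1 ∧ Concordant u.1 u.2.2}

/-- `q(x, β) = 1/2 + g(ψ(x)ᵀβ)/2`: the model probability of concordance given `Z₁ = Z₂ = x`. -/
def q (g : ℝ → ℝ) (ψ : Vec p → Vec d) (x : Vec p) (b : Vec d) : ℝ :=
  1 / 2 + g (∑ k, ψ x k * b k) / 2

/-- The log-likelihood `ℓ_β(w, z)` of a sign `w ∈ {1, -1}`. -/
def logLik (g : ℝ → ℝ) (ψ : Vec p → Vec d) (b : Vec d) (w : ℝ) (z : Vec p) : ℝ :=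
  (1 + w) / 2 * Real.log (q g ψ z b) + (1 - w) / 2 * Real.log (1 - q g ψ z b)

/-- `φ(x, y, β) = p(x, y) log q(x, β) + (1 - p(x, y)) log (1 - q(x, β))`. -/
def phi (κ : Kernel (Vec p) (ℝ × ℝ)) (g : ℝ → ℝ) (ψ : Vec p → Vec d)
    (x y : Vec p) (b : Vec d) : ℝ :=
  prob2 κ x y * Real.log (q g ψ x b) + (1 - prob2 κ x y) * Real.log (1 - q g ψ x b)

/-! The conditional second moments of the pairwise log-likelihoods, one for each way in which two
ordered pairs of distinct indices can share one or two indices. -/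

/-- `E[ℓ_β(W₍₁,₂₎, Z₁) ℓ_β(W₍₁,₃₎, Z₁) | Z₁ = x, Z₂ = y, Z₃ = z]`. -/
def momA (κ : Kernel (Vec p) (ℝ × ℝ)) (g : ℝ → ℝ) (ψ : Vec p → Vec d) (b : Vec d)
    (x y z : Vec p) : ℝ :=
  condE3 κ x y z fun x₁ x₂ x₃ => logLik g ψ b (W x₁ x₂) x * logLik g ψ b (W x₁ x₃) x

/-- `E[ℓ_β(W₍₁,₂₎, Z₁) ℓ_β(W₍₃,₁₎, Z₃) | Z₁ = x, Z₂ = y, Z₃ = z]`. -/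
def momB (κ : Kernel (Vec p) (ℝ × ℝ)) (g : ℝ → ℝ) (ψ : Vec p → Vec d) (b : Vec d)
    (x y z : Vec p) : ℝ :=
  condE3 κ x y z fun x₁ x₂ x₃ => logLik g ψ b (W x₁ x₂) x * logLik g ψ b (W x₃ x₁) z

/-- `E[ℓ_β(W₍₁,₂₎, Z₁) ℓ_β(W₍₃,₂₎, Z₃) | Z₁ = x, Z₂ = y, Z₃ = z]`. -/
def momC (κ : Kernel (Vec p) (ℝ × ℝ)) (g : ℝ → ℝ) (ψ : Vec p → Vec d) (b : Vec d)
    (x y z : Vec p) : ℝ :=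
  condE3 κ x y z fun x₁ x₂ x₃ => logLik g ψ b (W x₁ x₂) x * logLik g ψ b (W x₃ x₂) z

/-- `E[ℓ_β(W₍₁,₂₎, Z₁) ℓ_β(W₍₂,₃₎, Z₂) | Z₁ = x, Z₂ = y, Z₃ = z]`. -/
def momD (κ : Kernel (Vec p) (ℝ × ℝ)) (g : ℝ → ℝ) (ψ : Vec p → Vec d) (b : Vec d)
    (x y z : Vec p) : ℝ :=
  condE3 κ x y z fun x₁ x₂ x₃ => logLik g ψ b (W x₁ x₂) x * logLik g ψ b (W x₂ x₃) y

/-- `E[ℓ_β(W₍₁,₂₎, Z₁)² | Z₁ = x, Z₂ = y]`. -/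
def momE (κ : Kernel (Vec p) (ℝ × ℝ)) (g : ℝ → ℝ) (ψ : Vec p → Vec d) (b : Vec d)
    (x y : Vec p) : ℝ :=
  condE2 κ x y fun x₁ x₂ => logLik g ψ b (W x₁ x₂) x ^ 2

/-- `E[ℓ_β(W₍₁,₂₎, Z₁) ℓ_β(W₍₂,₁₎, Z₂) | Z₁ = x, Z₂ = y]`. -/
def momF (κ : Kernel (Vec p) (ℝ × ℝ)) (g : ℝ → ℝ) (ψ : Vec p → Vec d) (b : Vec d)
    (x y : Vec p) : ℝ :=
  condE2 κ x y fun x₁ x₂ => logLik g ψ b (W x₁ x₂) x * logLik g ψ b (W x₂ x₁) y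

end CondLaw

/-- `F_ε(x) = sup {|F(t)| : t ∈ S, |x - t| < ε}`, for a function `F` of interest on `S`, with values
in `[0, ∞]`. -/
def locSup {α : Type*} [PseudoMetricSpace α] (S : Set α) (ε : ℝ) (F : α → ℝ) (x : α) : ℝ≥0∞ :=
  ⨆ t ∈ {t | t ∈ S ∧ dist x t < ε}, ENNReal.ofReal |F t|

section Assumptions

variable {p d : ℕ}

/-- Regularity: the density `f` of `Z` is `m` times continuously differentiable, `φ(x, ·, β)` and
`q(·, β)` are continuous on `S` for all `x ∈ S` and all `β`, and `p(·, ·, ·)` is continuous on `S³`. -/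
structure Regular (κ : Kernel (Vec p) (ℝ × ℝ)) (g : ℝ → ℝ) (ψ : Vec p → Vec d)
    (S : Set (Vec p)) (f : Vec p → ℝ) (m : ℕ) : Prop where
  density : ContDiff ℝ m f
  phi_continuous : ∀ x ∈ S, ∀ b : Vec d, ContinuousOn (fun y => phi κ g ψ x y b) S
  q_continuous : ∀ b : Vec d, ContinuousOn (fun x => q g ψ x b) S
  prob3_continuous : ContinuousOn
    (fun u : Vec p × Vec p × Vec p => prob3 κ u.1 u.2.1 u.2.2) (S ×ˢ S ×ˢ S)

/-- First integrability condition at `β`, with radius `ε`. -/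
def IntegrabilityOne (κ : Kernel (Vec p) (ℝ × ℝ)) (g : ℝ → ℝ) (ψ : Vec p → Vec d)
    (S : Set (Vec p)) (f : Vec p → ℝ) (b : Vec d) (ε : ℝ) : Prop :=
  ∫⁻ z, (locSup (S ×ˢ S) ε (fun s => momA κ g ψ b z s.1 s.2) (z, z)
      + locSup (S ×ˢ S) ε (fun s => momB κ g ψ b z s.1 s.2) (z, z)
      + locSup (S ×ˢ S) ε (fun s => momC κ g ψ b s.1 z s.2) (z, z)
      + locSup (S ×ˢ S) ε (fun s => momD κ g ψ b s.1 z s.2) (z, z))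
    * locSup Set.univ ε f z ^ 2 * ENNReal.ofReal (f z) < ∞

/-- Second integrability condition at `β`, with radius `ε`. -/
def IntegrabilityTwo (κ : Kernel (Vec p) (ℝ × ℝ)) (g : ℝ → ℝ) (ψ : Vec p → Vec d)
    (S : Set (Vec p)) (f : Vec p → ℝ) (b : Vec d) (ε : ℝ) : Prop :=
  ∫⁻ z, (locSup S ε (fun y => phi κ g ψ z y b) z
      + locSup S ε (fun y => momE κ g ψ b z y) z
      + locSup S ε (fun y => momF κ g ψ b z y) z)
    * locSup Set.univ ε f z * ENNReal.ofReal (f z) < ∞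

end Assumptions

section Criterion

variable {p d : ℕ}

/-- The localized log-likelihood `L_n(β)` computed from the first `n` of the observations `(z i, x i)`,
with bandwidth `h`. -/
def Ln (K : Vec p → ℝ) (g : ℝ → ℝ) (ψ : Vec p → Vec d) (n : ℕ) (h : ℝ)
    (z : ℕ → Vec p) (x : ℕ → ℝ × ℝ) (b : Vec d) : ℝ :=
  1 / ((n : ℝ) * ((n : ℝ) - 1)) *
    ∑ i ∈ Finset.range n, ∑ j ∈ (Finset.range n).filter (fun j => i ≠ j),
      scaled K h (z i - z j) * logLik g ψ b (W (x i) (x j)) (z i)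

/-- `L_∞(β) = ∫ φ(z, z, β) f(z)² dz`. -/
def Linf (κ : Kernel (Vec p) (ℝ × ℝ)) (g : ℝ → ℝ) (ψ : Vec p → Vec d) (f : Vec p → ℝ)
    (b : Vec d) : ℝ :=
  ∫ z, phi κ g ψ z z b * f z ^ 2

/-- `b` maximizes `F`. -/
def IsArgmax (F : Vec d → ℝ) (b : Vec d) : Prop := ∀ b', F b' ≤ F b

/-- `b` is the unique maximizer of `F`. -/
def IsUniqueArgmax (F : Vec d → ℝ) (b : Vec d) : Prop := ∀ b', b' ≠ b → F b' < F b

end Criterion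

end CKT

end

/-! The argument splits into pointwise convergence in probability of the criterion and a
deterministic fact about concave functions.

Concavity replaces uniform convergence. If concave functions on a finite-dimensional space approach
a concave limit with a strict maximum at `c`, then smallness on a sphere around `c` follows from
closeness at finitely many points, by compactness and a reflection argument. Smallness on the sphere
propagates outwards by concavity, so that maximizers exist and lie near `c`
(`eventually_concave_argmax`). Product-topology neighbourhoods involve finitely many points, so
pointwise convergence in probability suffices (`tendstoInMeasure_argmax_of_concave`). The penalty,
converging and convex, is harmless.

For fixed β, `Ln` is a U-statistic whose kernel depends on n. The likelihood is truncated to a set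
where its two logarithms and the location are bounded. After truncation the sections of the kernel
have bounded integrals, while the second moment is of order `h ^ (-p)`. Counting shared indices
bounds the variance by O(1/n) + O(1/(n² h^p)), and the mean converges by dominated convergence. The
error of truncation is controlled in L¹: both logarithms are nonpositive, so the conditional mean of
the absolute value of the likelihood is exactly |φ|, and `exists_envelope` dominates the resulting
integrals by one integrable function, uniformly in small bandwidths (`tendstoInMeasure_uStat`,
`tendstoInMeasure_Ln`).

When the limiting penalty vanishes, the absence of ties turns the model into p(z, z) = q(z, β*), and
Gibbs' inequality shows that β* maximizes the integrand of `Linf` at almost every z; uniqueness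
identifies the maximizer. -/

namespace CKT

/-! ### Concave functions under pointwise convergence -/

section Concave

variable {V : Type*} [NormedAddCommGroup V] [NormedSpace ℝ V]

/-- The concave functions form a closed set for pointwise convergence. -/
lemma isClosed_setOf_concaveOn_univ :
    IsClosed {m : V → ℝ | ConcaveOn ℝ Set.univ m} := by
  have : {m : V → ℝ | ConcaveOn ℝ Set.univ m} = ⋂ (x : V) (y : V) (a : ℝ) (b : ℝ) (_ : 0 ≤ a)
      (_ : 0 ≤ b) (_ : a + b = 1), {m : V → ℝ | a • m x + b • m y ≤ m (a • x + b • y)} := by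
    ext m
    simp only [Set.mem_ofPred_eq, Set.mem_iInter]
    exact ⟨fun hm x y a b ha hb hab => hm.2 (Set.mem_univ _) (Set.mem_univ _) ha hb hab,
      fun hm => ⟨convex_univ, fun x _ y _ a b ha hb hab => hm x y a b ha hb hab⟩⟩
  rw [this]
  refine isClosed_iInter fun x => isClosed_iInter fun y => isClosed_iInter fun a =>
    isClosed_iInter fun b => isClosed_iInter fun _ => isClosed_iInter fun _ =>
    isClosed_iInter fun _ => isClosed_le ?_ ?_ <;> fun_prop

/-- A concave function that is smaller on a sphere than at its center is smaller than at the center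
everywhere outside of the sphere. -/
lemma concaveOn_lt_of_forall_sphere_lt {m : V → ℝ} (hm : ConcaveOn ℝ Set.univ m) {c : V} {r : ℝ}
    (hr : 0 < r) (hs : ∀ s ∈ Metric.sphere c r, m s < m c) {x : V} (hx : r ≤ dist x c) :
    m x < m c := by
  have hd : 0 < dist x c := hr.trans_le hx
  by_contra! hle
  set a : ℝ := r / dist x c with ha
  have ha0 : 0 ≤ a := by positivity
  have ha1 : a ≤ 1 := by rw [ha, div_le_one hd]; exact hx
  -- The segment from `c` to `x` meets the sphere here; if `m c ≤ m x`, concavity would force a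
  -- value at least `m c` at this point.
  have hmem : (1 - a) • c + a • x ∈ Metric.sphere c r := by
    have : (1 - a) • c + a • x - c = a • (x - c) := by module
    rw [mem_sphere_iff_norm, this, norm_smul, Real.norm_of_nonneg ha0, ← dist_eq_norm, ha]
    field_simp
  have h1 := hs _ hmem
  have h2 := hm.2 (Set.mem_univ c) (Set.mem_univ x) (sub_nonneg.2 ha1) ha0 (by ring)
  simp only [smul_eq_mul] at h2
  nlinarith

variable [FiniteDimensional ℝ V]

/-- In finite dimension a concave function is continuous, so it has a maximum on the closed ball,
and values outside the ball stay below the value at the center. -/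
lemma concaveOn_exists_forall_le {m : V → ℝ} (hm : ConcaveOn ℝ Set.univ m)
    {c : V} {r : ℝ} (hr : 0 < r) (hs : ∀ s ∈ Metric.sphere c r, m s < m c) :
    ∃ b, ∀ x, m x ≤ m b := by
  have hc : ContinuousOn m (Metric.closedBall c r) :=
    (hm.locallyLipschitz).continuous.continuousOn
  obtain ⟨b, -, hb⟩ := (isCompact_closedBall c r).exists_isMaxOn
    ⟨c, Metric.mem_closedBall_self hr.le⟩ hc
  refine ⟨b, fun x => ?_⟩
  rcases le_or_gt (dist x c) r with hx | hx
  · exact hb hx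
  · exact (concaveOn_lt_of_forall_sphere_lt hm hr hs hx.le).le.trans
      (hb (Metric.mem_closedBall_self hr.le))

/-- Pointwise convergence of concave functions is locally uniform from above. -/
lemma eventually_concave_lt {M : V → ℝ} (hM : ConcaveOn ℝ Set.univ M) {s : V} {a : ℝ}
    (ha : M s < a) :
    ∀ᶠ z in 𝓝[{m : V → ℝ | ConcaveOn ℝ Set.univ m}] M ×ˢ 𝓝 s, z.1 z.2 < a := by
  -- Four units of slack: the midpoint inequality gives `m x ≤ 2 * m s - m (2 • s - x)`, where `m s
  -- < M s + η` costs two units and the lower bound `M s - 2 * η` at the reflected point costs two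
  -- more.
  set η := (a - M s) / 4 with hη
  have hη0 : 0 < η := by rw [hη]; linarith
  have hcont : Continuous M := (hM.locallyLipschitz).continuous
  have hU : {x | M s - η < M x} ∈ 𝓝 s :=
    hcont.continuousAt.eventually (lt_mem_nhds (by linarith))
  -- Lower bounds at the finitely many vertices of a simplex around `s` pass to the whole simplex by
  -- concavity. The upper bound near `s` then comes from reflecting in `s`.
  obtain ⟨B, hB, hBs⟩ := exists_mem_interior_convexHull_affineBasis hU
  have hvert : ∀ᶠ m in 𝓝 M, ∀ i, M s - 2 * η < m (B i) := by
    rw [eventually_all]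
    intro i
    have h1 : M s - η < M (B i) := hBs (subset_convexHull ℝ _ (Set.mem_range_self i))
    exact (continuous_apply (B i)).continuousAt.eventually (lt_mem_nhds (by linarith))
  have hs : ∀ᶠ m in 𝓝 M, m s < M s + η :=
    (continuous_apply s).continuousAt.eventually (gt_mem_nhds (by linarith))
  have hrefl : ∀ᶠ x in 𝓝 s, (2 : ℝ) • s - x ∈ convexHull ℝ (Set.range B) := by
    have : Tendsto (fun x => (2 : ℝ) • s - x) (𝓝 s) (𝓝 ((2 : ℝ) • s - s)) :=
      (continuous_const.sub continuous_id).continuousAt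
    rw [show (2 : ℝ) • s - s = s by module] at this
    exact this.eventually (mem_interior_iff_mem_nhds.1 hB)
  have hfst : ∀ᶠ m in 𝓝[{m : V → ℝ | ConcaveOn ℝ Set.univ m}] M,
      ConcaveOn ℝ Set.univ m ∧ (∀ i, M s - 2 * η < m (B i)) ∧ m s < M s + η :=
    eventually_mem_nhdsWithin.and (nhdsWithin_le_nhds (hvert.and hs))
  filter_upwards [hfst.prod_mk hrefl] with ⟨m, x⟩ ⟨⟨hm, h1, h2⟩, h3⟩
  obtain ⟨y, ⟨i, rfl⟩, hy⟩ := (hm.subset (Set.subset_univ _)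
    (convex_convexHull ℝ _)).exists_le_of_mem_convexHull (subset_convexHull ℝ _) h3
  have h4 := hm.2 (Set.mem_univ x) (Set.mem_univ ((2 : ℝ) • s - x))
    (by norm_num : (0 : ℝ) ≤ 1 / 2) (by norm_num : (0 : ℝ) ≤ 1 / 2) (by norm_num)
  rw [show (1 / 2 : ℝ) • x + (1 / 2 : ℝ) • ((2 : ℝ) • s - x) = s by module] at h4
  simp only [smul_eq_mul] at h4
  have := h1 i
  simp only at *
  linarith

/-- If the concave function `M` has a strict global maximum at `c`, then every concave function
close to `M` at finitely many suitable points has a global maximum, and only near `c`. -/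
lemma eventually_concave_argmax {M : V → ℝ} (hM : ConcaveOn ℝ Set.univ M) {c : V}
    (hc : ∀ x, x ≠ c → M x < M c) {r : ℝ} (hr : 0 < r) :
    ∀ᶠ m in 𝓝[{m : V → ℝ | ConcaveOn ℝ Set.univ m}] M,
      (∃ b, ∀ x, m x ≤ m b) ∧ ∀ b, (∀ x, m x ≤ m b) → dist b c < r := by
  have hsph : ∀ᶠ m in 𝓝[{m : V → ℝ | ConcaveOn ℝ Set.univ m}] M,
      ∀ s ∈ Metric.sphere c r, m s < m c := by
    have key : ∀ s ∈ Metric.sphere c r, ∃ U ∈ 𝓝 s,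
        ∀ᶠ m in 𝓝[{m : V → ℝ | ConcaveOn ℝ Set.univ m}] M, ∀ x ∈ U, m x < m c := by
      intro s hs
      have hlt := hc s (Metric.ne_of_mem_sphere hs hr.ne')
      obtain ⟨a, ha1, ha2⟩ := exists_between hlt
      have h1 := eventually_concave_lt hM ha1
      obtain ⟨p, hp, q, hq, hpq⟩ := eventually_prod_iff.1 h1
      refine ⟨{x | q x}, hq, ?_⟩
      have h2 : ∀ᶠ m in 𝓝[{m : V → ℝ | ConcaveOn ℝ Set.univ m}] M, a < m c :=
        nhdsWithin_le_nhds ((continuous_apply c).continuousAt.eventually (lt_mem_nhds ha2))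
      filter_upwards [hp, h2] with m hm1 hm2 x hx
      exact (hpq hm1 hx).trans hm2
    choose! U hU hev using key
    obtain ⟨t, hts, hcover⟩ := (isCompact_sphere c r).elim_nhds_subcover U hU
    have := (eventually_all_finset t).2 fun s hs => hev s (hts s hs)
    filter_upwards [this] with m hm s hs
    obtain ⟨i, hi, hsi⟩ := Set.mem_iUnion₂.1 (hcover hs)
    exact hm i hi s hsi
  filter_upwards [hsph, eventually_mem_nhdsWithin] with m hm hconc
  refine ⟨concaveOn_exists_forall_le hconc hr hm, fun b hb => ?_⟩
  by_contra! hle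
  exact (concaveOn_lt_of_forall_sphere_lt hconc hr hm hle).not_ge (hb c)

end Concave

/-! ### Maximizers of random concave functions -/

section Argmax

variable {Ω : Type*} [MeasurableSpace Ω] {P : Measure Ω}

/-- Pointwise convergence in probability to a deterministic function is convergence in probability
for the topology of pointwise convergence. -/
lemma tendsto_measure_notMem_of_tendstoInMeasure {V : Type*} {M : ℕ → Ω → V → ℝ} {M₀ : V → ℝ}
    (h : ∀ x, TendstoInMeasure P (fun n ω => M n ω x) atTop (fun _ => M₀ x))
    {U : Set (V → ℝ)} (hU : U ∈ 𝓝 M₀) : Tendsto (fun n => P {ω | M n ω ∉ U}) atTop (𝓝 0) := by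
  rw [nhds_pi, Filter.mem_pi] at hU
  obtain ⟨I, hI, t, ht, htU⟩ := hU
  have hε : ∀ x, ∃ ε > 0, Metric.ball (M₀ x) ε ⊆ t x := fun x => Metric.mem_nhds_iff.1 (ht x)
  choose ε hε0 hεt using hε
  have hlim : Tendsto (fun n => ∑ x ∈ hI.toFinset,
      P {ω | ENNReal.ofReal (ε x) ≤ edist (M n ω x) (M₀ x)}) atTop (𝓝 0) := by
    rw [← Finset.sum_const_zero (s := hI.toFinset)]
    exact tendsto_finsetSum _ fun x _ => h x _ (ENNReal.ofReal_pos.2 (hε0 x))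
  refine tendsto_of_tendsto_of_tendsto_of_le_of_le tendsto_const_nhds hlim (fun _ => zero_le)
    fun n => (measure_mono fun ω hω => ?_).trans (measure_biUnion_finset_le _ _)
  by_contra hcon
  refine hω (htU fun x hx => hεt x ?_)
  simp only [Set.mem_iUnion, Set.mem_ofPred_eq, not_exists, not_le] at hcon
  have := hcon x (hI.mem_toFinset.2 hx)
  rw [edist_dist] at this
  exact (ENNReal.ofReal_lt_ofReal_iff (hε0 x)).1 this

/-- Every neighbourhood of the limit contains some concave realization, since `M n` falls in it with
positive probability for large n; the concave functions form a closed set. -/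
lemma concaveOn_of_tendstoInMeasure [IsProbabilityMeasure P] {V : Type*} [NormedAddCommGroup V]
    [NormedSpace ℝ V] {M : ℕ → Ω → V → ℝ} {M₀ : V → ℝ}
    (h : ∀ x, TendstoInMeasure P (fun n ω => M n ω x) atTop (fun _ => M₀ x))
    (hM : ∀ n, ∀ᵐ ω ∂P, ConcaveOn ℝ Set.univ (M n ω)) : ConcaveOn ℝ Set.univ M₀ := by
  refine isClosed_setOf_concaveOn_univ.closure_subset (mem_closure_iff_nhds.2 fun U hU => ?_)
  have h1 := (tendsto_measure_notMem_of_tendstoInMeasure h hU).eventually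
    (gt_mem_nhds zero_lt_one)
  obtain ⟨n, hn⟩ := h1.exists
  by_contra hcon
  have hae : ∀ᵐ ω ∂P, M n ω ∉ U := by
    filter_upwards [hM n] with ω hω hmem
    exact hcon ⟨M n ω, hmem, hω⟩
  rw [measure_congr (t := Set.univ) (eventuallyEq_univ.2 hae), measure_univ] at hn
  exact lt_irrefl _ hn

/-- Maximizers of random concave functions that converge pointwise in probability to a function
with a unique maximizer converge in probability to that maximizer. -/
theorem tendstoInMeasure_argmax_of_concave [IsProbabilityMeasure P] {V : Type*}
    [NormedAddCommGroup V] [NormedSpace ℝ V] [FiniteDimensional ℝ V] {M : ℕ → Ω → V → ℝ}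
    {M₀ : V → ℝ} (h : ∀ x, TendstoInMeasure P (fun n ω => M n ω x) atTop (fun _ => M₀ x))
    (hM : ∀ n, ∀ᵐ ω ∂P, ConcaveOn ℝ Set.univ (M n ω)) {b : ℕ → Ω → V}
    (hb : ∀ n, ∀ᵐ ω ∂P, (∃ b', ∀ x, M n ω x ≤ M n ω b') → ∀ x, M n ω x ≤ M n ω (b n ω))
    {c : V} (hc : ∀ x, x ≠ c → M₀ x < M₀ c) :
    TendstoInMeasure P b atTop (fun _ => c) := by
  rw [tendstoInMeasure_iff_dist]
  intro r hr
  obtain ⟨U, hU, hUsub⟩ := mem_nhdsWithin_iff_exists_mem_nhds_inter.1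
    (eventually_concave_argmax (concaveOn_of_tendstoInMeasure h hM) hc hr)
  refine tendsto_of_tendsto_of_tendsto_of_le_of_le tendsto_const_nhds
    (tendsto_measure_notMem_of_tendstoInMeasure h hU) (fun _ => zero_le)
    fun n => measure_mono_ae ?_
  filter_upwards [hM n, hb n] with ω h1 h2 h3 h4
  have h5 := hUsub ⟨h4, h1⟩
  exact (h5.2 _ (h2 h5.1)).not_ge h3

end Argmax

/-! ### Weak law of large numbers for U-statistics of order two -/

section UStatistic

variable {Ω : Type*} [MeasurableSpace Ω] {P : Measure Ω} [IsProbabilityMeasure P]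
  {E : Type*} [MeasurableSpace E] {Y : ℕ → Ω → E} {μ : Measure E}

/-- The U-statistic with kernel `H` of the first `n` of the observations `y`. -/
noncomputable def uStat (n : ℕ) (H : E × E → ℝ) (y : ℕ → E) : ℝ :=
  1 / ((n : ℝ) * ((n : ℝ) - 1)) * ∑ a ∈ (Finset.range n).offDiag, H (y a.1, y a.2)

lemma map_pair_eq_prod (hY : ∀ i, Measurable (Y i)) (hind : iIndepFun Y P)
    (hlaw : ∀ i, P.map (Y i) = μ) {i j : ℕ} (hij : i ≠ j) :
    P.map (fun ω => (Y i ω, Y j ω)) = μ.prod μ := by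
  rw [(indepFun_iff_map_prod_eq_prod_map_map (hY i).aemeasurable (hY j).aemeasurable).1
    (hind.indepFun hij), hlaw, hlaw]

/-- The index `j` occurs only in the first factor, so `Y j` can be integrated out first,
conditionally on the other observations. This handles pairs sharing a single index. -/
lemma lintegral_mul_le_of_section_le [IsProbabilityMeasure μ] (hY : ∀ i, Measurable (Y i))
    (hind : iIndepFun Y P) (hlaw : ∀ i, P.map (Y i) = μ) {G G' : E × E → ℝ≥0∞} (hG : Measurable G) (hG' : Measurable G')
    {C : ℝ≥0∞} (hC : ∀ y, ∫⁻ y', G (y, y') ∂μ ≤ C) {i j k l : ℕ} (hij : j ≠ i) (hkj : j ≠ k)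
    (hlj : j ≠ l) :
    ∫⁻ ω, G (Y i ω, Y j ω) * G' (Y k ω, Y l ω) ∂P ≤ C * ∫⁻ ω, G' (Y k ω, Y l ω) ∂P := by
  set T : Ω → E × E × E := fun ω => (Y i ω, Y k ω, Y l ω) with hT
  have hTm : Measurable T := (hY i).prodMk ((hY k).prodMk (hY l))
  have hTY : IndepFun T (Y j) P := by
    have h1 := hind.indepFun_finset {i, k, l} {j} (by simp [hij, hkj, hlj]) hY
    exact h1.comp (φ := fun v : (({i, k, l} : Finset ℕ) → E) =>
        (v ⟨i, by simp⟩, v ⟨k, by simp⟩, v ⟨l, by simp⟩))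
      (ψ := fun v : (({j} : Finset ℕ) → E) => v ⟨j, by simp⟩) (by fun_prop) (by fun_prop)
  have hmap := (indepFun_iff_map_prod_eq_prod_map_map hTm.aemeasurable (hY j).aemeasurable).1 hTY
  have hF : Measurable fun u : (E × E × E) × E => G (u.1.1, u.2) * G' u.1.2 := by fun_prop
  calc ∫⁻ ω, G (Y i ω, Y j ω) * G' (Y k ω, Y l ω) ∂P
      = ∫⁻ u, G (u.1.1, u.2) * G' u.1.2 ∂(P.map fun ω => (T ω, Y j ω)) := by
        rw [lintegral_map hF (hTm.prodMk (hY j))]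
    _ = ∫⁻ t, ∫⁻ y, G (t.1, y) * G' t.2 ∂μ ∂(P.map T) := by
        rw [hmap, hlaw, lintegral_prod _ hF.aemeasurable]
    _ ≤ ∫⁻ t, C * G' t.2 ∂(P.map T) := by
        refine lintegral_mono fun t => ?_
        rw [lintegral_mul_const _ (by fun_prop)]
        gcongr
        exact hC t.1
    _ = C * ∫⁻ ω, G' (Y k ω, Y l ω) ∂P := by
        rw [lintegral_const_mul _ (by fun_prop), lintegral_map (by fun_prop) hTm]

/-- The variance of the sum of a kernel over all ordered pairs of distinct observations. -/
lemma variance_sum_offDiag_le [IsProbabilityMeasure μ] (hY : ∀ i, Measurable (Y i))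
    (hind : iIndepFun Y P) (hlaw : ∀ i, P.map (Y i) = μ) {H : E × E → ℝ} (hH : Measurable H) {C D : ℝ} (hC0 : 0 ≤ C)
    (hD0 : 0 ≤ D) (hl : ∀ y, ∫⁻ y', ‖H (y, y')‖ₑ ∂μ ≤ ENNReal.ofReal C)
    (hr : ∀ y', ∫⁻ y, ‖H (y, y')‖ₑ ∂μ ≤ ENNReal.ofReal C)
    (hD : ∫⁻ u, ‖H u‖ₑ ^ 2 ∂(μ.prod μ) ≤ ENNReal.ofReal D) (n : ℕ) :
    Var[fun ω => ∑ a ∈ (Finset.range n).offDiag, H (Y a.1 ω, Y a.2 ω); P] ≤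
      (n : ℝ) ^ 2 * (4 * n * C ^ 2 + 2 * D) := by
  have hpm : ∀ a : ℕ × ℕ, Measurable fun ω => (Y a.1 ω, Y a.2 ω) := fun a =>
    (hY a.1).prodMk (hY a.2)
  have hXm : ∀ a : ℕ × ℕ, Measurable fun ω => H (Y a.1 ω, Y a.2 ω) := fun a => hH.comp (hpm a)
  have hlint : ∀ {F : E × E → ℝ≥0∞}, Measurable F → ∀ {a : ℕ × ℕ}, a.1 ≠ a.2 →
      ∫⁻ ω, F (Y a.1 ω, Y a.2 ω) ∂P = ∫⁻ u, F u ∂(μ.prod μ) := by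
    intro F hF a ha
    rw [← map_pair_eq_prod hY hind hlaw ha, lintegral_map hF (hpm a)]
  have hsq : ∀ a : ℕ × ℕ, a.1 ≠ a.2 →
      ∫⁻ ω, ‖H (Y a.1 ω, Y a.2 ω)‖ₑ ^ 2 ∂P ≤ ENNReal.ofReal D := fun a ha => by
    rw [hlint (F := fun u => ‖H u‖ₑ ^ 2) (by fun_prop) ha]
    exact hD
  have hmem : ∀ a : ℕ × ℕ, a.1 ≠ a.2 → MemLp (fun ω => H (Y a.1 ω, Y a.2 ω)) 2 P := by
    intro a ha
    refine ⟨(hXm a).aestronglyMeasurable, ?_⟩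
    rw [eLpNorm_lt_top_iff_lintegral_rpow_enorm_lt_top (by norm_num) (by norm_num)]
    have : ((2 : ℝ≥0∞).toReal) = ((2 : ℕ) : ℝ) := by simp
    simp only [this, ENNReal.rpow_natCast]
    exact (hsq a ha).trans_lt ENNReal.ofReal_lt_top
  have hmean : ∀ a : ℕ × ℕ, a.1 ≠ a.2 →
      ∫ ω, H (Y a.1 ω, Y a.2 ω) ∂P = ∫ u, H u ∂(μ.prod μ) := by
    intro a ha
    rw [← map_pair_eq_prod hY hind hlaw ha, integral_map (hpm a).aemeasurable
      hH.aestronglyMeasurable]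
  have hfirst : ∀ a : ℕ × ℕ, a.1 ≠ a.2 →
      ∫⁻ ω, ‖H (Y a.1 ω, Y a.2 ω)‖ₑ ∂P ≤ ENNReal.ofReal C := by
    intro a ha
    rw [hlint (F := fun u => ‖H u‖ₑ) (by fun_prop) ha, lintegral_prod _ (by fun_prop)]
    calc ∫⁻ y, ∫⁻ y', ‖H (y, y')‖ₑ ∂μ ∂μ ≤ ∫⁻ _, ENNReal.ofReal C ∂μ := lintegral_mono hl
      _ = ENNReal.ofReal C := by simp
  -- All pairs have the same mean, so the product of means is a square and may be dropped from the
  -- covariance.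
  have hcov : ∀ a b : ℕ × ℕ, a.1 ≠ a.2 → b.1 ≠ b.2 → ∀ B : ℝ, 0 ≤ B →
      ∫⁻ ω, ‖H (Y a.1 ω, Y a.2 ω)‖ₑ * ‖H (Y b.1 ω, Y b.2 ω)‖ₑ ∂P ≤ ENNReal.ofReal B →
      cov[fun ω => H (Y a.1 ω, Y a.2 ω), fun ω => H (Y b.1 ω, Y b.2 ω); P] ≤ B := by
    intro a b ha hb B hB0 hB
    rw [covariance_eq_sub (hmem a ha) (hmem b hb), hmean a ha, hmean b hb]
    have h1 : ∫ ω, ((fun ω => H (Y a.1 ω, Y a.2 ω)) * fun ω => H (Y b.1 ω, Y b.2 ω)) ω ∂P ≤ B := by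
      refine (le_abs_self _).trans ?_
      rw [← Real.norm_eq_abs]
      refine (norm_integral_le_lintegral_norm _).trans (ENNReal.toReal_le_of_le_ofReal hB0 ?_)
      simpa only [Pi.mul_apply, norm_mul, ofReal_norm, ENNReal.ofReal_mul (norm_nonneg _)]
        using hB
    nlinarith [mul_self_nonneg (∫ u, H u ∂(μ.prod μ))]
  -- Disjoint pairs are independent and contribute zero. With one shared index, integrating out a
  -- free observation gives `C ^ 2`. With both shared, `2xy ≤ x² + y²` gives `D`. The indicators
  -- count these coincidences, with multiplicity.
  have hbound : ∀ a ∈ (Finset.range n).offDiag, ∀ b ∈ (Finset.range n).offDiag,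
      cov[fun ω => H (Y a.1 ω, Y a.2 ω), fun ω => H (Y b.1 ω, Y b.2 ω); P] ≤
      C ^ 2 * ((if a.1 = b.1 then 1 else 0) + (if a.1 = b.2 then 1 else 0) +
        (if a.2 = b.1 then 1 else 0) + (if a.2 = b.2 then 1 else 0)) +
      D * ((if a = b then 1 else 0) + (if a.swap = b then 1 else 0)) := by
    rintro ⟨i, j⟩ ha ⟨k, l⟩ hb
    have hij : i ≠ j := (Finset.mem_offDiag.1 ha).2.2
    have hkl : k ≠ l := (Finset.mem_offDiag.1 hb).2.2
    have hC2 : 0 ≤ C ^ 2 := by positivity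
    have hCC : ENNReal.ofReal (C ^ 2) = ENNReal.ofReal C * ENNReal.ofReal C := by
      rw [pow_two, ENNReal.ofReal_mul hC0]
    by_cases hj : j ≠ k ∧ j ≠ l
    · by_cases hi : i ≠ k ∧ i ≠ l
      · have h0 := ((hind.indepFun_prodMk_prodMk hY i j k l hi.1 hi.2 hj.1 hj.2).comp hH
          hH).covariance_eq_zero (hmem (i, j) hij) (hmem (k, l) hkl)
        refine (le_of_eq h0).trans ?_
        positivity
      · have h1 : cov[fun ω => H (Y i ω, Y j ω), fun ω => H (Y k ω, Y l ω); P] ≤ C ^ 2 := by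
          refine hcov (i, j) (k, l) hij hkl _ hC2 ?_
          rw [hCC]
          refine (lintegral_mul_le_of_section_le hY hind hlaw (G := fun u => ‖H u‖ₑ)
            (G' := fun u => ‖H u‖ₑ) (by fun_prop) (by fun_prop) hl hij.symm hj.1 hj.2).trans ?_
          gcongr
          exact hfirst (k, l) hkl
        refine h1.trans ?_
        rw [not_and_or, not_not, not_not] at hi
        have h2 : (0 : ℝ) ≤ D * ((if (i, j) = (k, l) then 1 else 0) +
          (if (i, j).swap = (k, l) then 1 else 0)) := by positivity
        have h3 : (1 : ℝ) ≤ ((if i = k then 1 else 0) + (if i = l then 1 else 0) +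
          (if j = k then 1 else 0) + (if j = l then 1 else 0)) := by
          rcases hi with hi | hi <;> simp only [hi, if_true] <;> split_ifs <;> norm_num
        dsimp only
        nlinarith
    · by_cases hi : i ≠ k ∧ i ≠ l
      · have h1 : cov[fun ω => H (Y i ω, Y j ω), fun ω => H (Y k ω, Y l ω); P] ≤ C ^ 2 := by
          refine hcov (i, j) (k, l) hij hkl _ hC2 ?_
          rw [hCC]
          refine (lintegral_mul_le_of_section_le hY hind hlaw (G := fun u => ‖H u.swap‖ₑ)
            (G' := fun u => ‖H u‖ₑ) (by fun_prop) (by fun_prop) hr (i := j) (j := i) hij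
            hi.1 hi.2).trans ?_
          gcongr
          exact hfirst (k, l) hkl
        refine h1.trans ?_
        rw [not_and_or, not_not, not_not] at hj
        have h2 : (0 : ℝ) ≤ D * ((if (i, j) = (k, l) then 1 else 0) +
          (if (i, j).swap = (k, l) then 1 else 0)) := by positivity
        have h3 : (1 : ℝ) ≤ ((if i = k then 1 else 0) + (if i = l then 1 else 0) +
          (if j = k then 1 else 0) + (if j = l then 1 else 0)) := by
          rcases hj with hj | hj <;> simp only [hj, if_true] <;> split_ifs <;> norm_num
        dsimp only
        nlinarith
      · have h1 : cov[fun ω => H (Y i ω, Y j ω), fun ω => H (Y k ω, Y l ω); P] ≤ D := by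
          refine hcov (i, j) (k, l) hij hkl _ hD0 ?_
          calc ∫⁻ ω, ‖H (Y i ω, Y j ω)‖ₑ * ‖H (Y k ω, Y l ω)‖ₑ ∂P
              ≤ ∫⁻ ω, (‖H (Y i ω, Y j ω)‖ₑ ^ 2 / 2 + ‖H (Y k ω, Y l ω)‖ₑ ^ 2 / 2) ∂P := by
                refine lintegral_mono fun ω => ?_
                simpa using ENNReal.young_inequality ‖H (Y i ω, Y j ω)‖ₑ ‖H (Y k ω, Y l ω)‖ₑ
                  Real.HolderConjugate.two_two
            _ = (∫⁻ ω, ‖H (Y i ω, Y j ω)‖ₑ ^ 2 ∂P) / 2 +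
                (∫⁻ ω, ‖H (Y k ω, Y l ω)‖ₑ ^ 2 ∂P) / 2 := by
                have hm1 := hXm (i, j)
                have hm2 := hXm (k, l)
                simp only [div_eq_mul_inv]
                rw [lintegral_add_left (by fun_prop), lintegral_mul_const _ (by fun_prop),
                  lintegral_mul_const _ (by fun_prop)]
            _ ≤ ENNReal.ofReal D / 2 + ENNReal.ofReal D / 2 := by
                gcongr
                · exact hsq (i, j) hij
                · exact hsq (k, l) hkl
            _ = ENNReal.ofReal D := ENNReal.add_halves _
        refine h1.trans ?_
        have h2 : (0 : ℝ) ≤ C ^ 2 * ((if i = k then 1 else 0) + (if i = l then 1 else 0) +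
          (if j = k then 1 else 0) + (if j = l then 1 else 0)) := by positivity
        have h3 : (1 : ℝ) ≤ ((if (i, j) = (k, l) then 1 else 0) +
            (if (i, j).swap = (k, l) then 1 else 0)) := by
          have : (i, j) = (k, l) ∨ (i, j).swap = (k, l) := by
            simp only [Prod.mk.injEq, Prod.swap_prod_mk]
            omega
          rcases this with h | h <;> simp only [h, if_true] <;> split_ifs <;> norm_num
        dsimp only
        nlinarith
  rw [variance_fun_sum' fun a ha => hmem a (Finset.mem_offDiag.1 ha).2.2]
  have hcard : ((Finset.range n).offDiag.card : ℝ) ≤ (n : ℝ) ^ 2 := by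
    rw [Finset.offDiag_card, Finset.card_range, pow_two]
    exact_mod_cast Nat.sub_le _ _
  have hrow : ∀ a ∈ (Finset.range n).offDiag, ∑ b ∈ (Finset.range n).offDiag,
      cov[fun ω => H (Y a.1 ω, Y a.2 ω), fun ω => H (Y b.1 ω, Y b.2 ω); P] ≤
      4 * n * C ^ 2 + 2 * D := by
    intro a ha
    refine (Finset.sum_le_sum (hbound a ha)).trans ?_
    -- Including diagonal `b` only enlarges the bound and makes the count exact: each of the four
    -- coincidences of one index contributes `n`, and `a` and `a.swap` contribute one each.
    refine (Finset.sum_le_sum_of_subset_of_nonneg (t := Finset.range n ×ˢ Finset.range n)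
      (by intro b hb; simp only [Finset.mem_offDiag] at hb; simp [hb.1, hb.2.1])
      fun b _ _ => by positivity).trans ?_
    obtain ⟨i, j⟩ := a
    have hi : i ∈ Finset.range n := (Finset.mem_offDiag.1 ha).1
    have hj : j ∈ Finset.range n := (Finset.mem_offDiag.1 ha).2.1
    rw [Finset.sum_add_distrib, ← Finset.mul_sum, ← Finset.mul_sum]
    simp only [Finset.sum_add_distrib, Finset.sum_ite_eq, Finset.mem_product, Prod.fst_swap,
      Prod.snd_swap, hi, hj, and_self, if_true]
    simp only [Finset.sum_product, Finset.sum_ite_eq, hi, hj, if_true, Finset.sum_const,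
      Finset.card_range, nsmul_eq_mul, mul_one]
    have hcol : ∀ k ∈ Finset.range n,
        ∑ x ∈ Finset.range n, ∑ _y ∈ Finset.range n, (if k = x then (1 : ℝ) else 0) = n := by
      intro k hk
      rw [Finset.sum_comm]
      simp only [Finset.sum_ite_eq, hk, if_true, Finset.sum_const, Finset.card_range,
        nsmul_eq_mul, mul_one]
    rw [hcol i hi, hcol j hj]
    linarith
  refine (Finset.sum_le_sum hrow).trans ?_
  rw [Finset.sum_const, nsmul_eq_mul]
  gcongr

lemma measurable_uStat (hY : ∀ i, Measurable (Y i)) {H : E × E → ℝ} (hH : Measurable H) (n : ℕ) :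
    Measurable fun ω => uStat n H (fun i => Y i ω) :=
  (Finset.measurable_sum _ fun a _ => hH.comp ((hY a.1).prodMk (hY a.2))).const_mul _

lemma card_offDiag_range (n : ℕ) :
    ((Finset.range n).offDiag.card : ℝ) = (n : ℝ) * ((n : ℝ) - 1) := by
  rw [Finset.offDiag_card, Finset.card_range, Nat.cast_sub (Nat.le_mul_self n)]
  push_cast
  ring

/-- Averaging does not increase the L¹ norm. Applied to a difference of kernels, this gives the cost
of truncation, uniformly in `n`. -/
lemma lintegral_enorm_uStat_le (hY : ∀ i, Measurable (Y i)) (hind : iIndepFun Y P)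
    (hlaw : ∀ i, P.map (Y i) = μ) {H : E × E → ℝ} (hH : Measurable H) {n : ℕ} (hn : 2 ≤ n) :
    ∫⁻ ω, ‖uStat n H (fun i => Y i ω)‖ₑ ∂P ≤ ∫⁻ u, ‖H u‖ₑ ∂(μ.prod μ) := by
  have hpm : ∀ a : ℕ × ℕ, Measurable fun ω => (Y a.1 ω, Y a.2 ω) := fun a =>
    (hY a.1).prodMk (hY a.2)
  have hXm : ∀ a : ℕ × ℕ, Measurable fun ω => ‖H (Y a.1 ω, Y a.2 ω)‖ₑ := fun a =>
    (hH.comp (hpm a)).enorm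
  have hn' : (2 : ℝ) ≤ n := by exact_mod_cast hn
  have hpos : 0 < (n : ℝ) * ((n : ℝ) - 1) := by nlinarith
  calc ∫⁻ ω, ‖uStat n H (fun i => Y i ω)‖ₑ ∂P
      ≤ ∫⁻ ω, ENNReal.ofReal (1 / ((n : ℝ) * ((n : ℝ) - 1))) *
          ∑ a ∈ (Finset.range n).offDiag, ‖H (Y a.1 ω, Y a.2 ω)‖ₑ ∂P := by
        refine lintegral_mono fun ω => ?_
        rw [uStat, enorm_mul, Real.enorm_of_nonneg (by positivity)]
        gcongr
        exact enorm_sum_le _ _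
    _ = ENNReal.ofReal (1 / ((n : ℝ) * ((n : ℝ) - 1))) *
          ∑ a ∈ (Finset.range n).offDiag, ∫⁻ ω, ‖H (Y a.1 ω, Y a.2 ω)‖ₑ ∂P := by
        rw [lintegral_const_mul' _ _ ENNReal.ofReal_ne_top,
          lintegral_finsetSum _ fun a _ => hXm a]
    _ = ENNReal.ofReal (1 / ((n : ℝ) * ((n : ℝ) - 1))) *
          ∑ a ∈ (Finset.range n).offDiag, ∫⁻ u, ‖H u‖ₑ ∂(μ.prod μ) := by
        congr 1
        refine Finset.sum_congr rfl fun a ha => ?_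
        rw [← map_pair_eq_prod hY hind hlaw (Finset.mem_offDiag.1 ha).2.2,
          lintegral_map hH.enorm (hpm a)]
    _ = ∫⁻ u, ‖H u‖ₑ ∂(μ.prod μ) := by
        rw [Finset.sum_const, nsmul_eq_mul, ← mul_assoc, ← ENNReal.ofReal_natCast,
          card_offDiag_range, ← ENNReal.ofReal_mul (by positivity), one_div,
          inv_mul_cancel₀ hpos.ne', ENNReal.ofReal_one, one_mul]

lemma integral_uStat (hY : ∀ i, Measurable (Y i)) (hind : iIndepFun Y P)
    (hlaw : ∀ i, P.map (Y i) = μ) {H : E × E → ℝ} (hH : Integrable H (μ.prod μ)) {n : ℕ}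
    (hn : 2 ≤ n) :
    ∫ ω, uStat n H (fun i => Y i ω) ∂P = ∫ u, H u ∂(μ.prod μ) := by
  have hpm : ∀ a : ℕ × ℕ, Measurable fun ω => (Y a.1 ω, Y a.2 ω) := fun a =>
    (hY a.1).prodMk (hY a.2)
  have hn' : (2 : ℝ) ≤ n := by exact_mod_cast hn
  have hpos : 0 < (n : ℝ) * ((n : ℝ) - 1) := by nlinarith
  have hterm : ∀ a ∈ (Finset.range n).offDiag, Integrable (fun ω => H (Y a.1 ω, Y a.2 ω)) P ∧
      ∫ ω, H (Y a.1 ω, Y a.2 ω) ∂P = ∫ u, H u ∂(μ.prod μ) := by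
    intro a ha
    have hmap := map_pair_eq_prod hY hind hlaw (Finset.mem_offDiag.1 ha).2.2
    rw [← hmap] at hH ⊢
    exact ⟨hH.comp_measurable (hpm a), (integral_map (hpm a).aemeasurable hH.1).symm⟩
  simp only [uStat]
  rw [integral_const_mul, integral_finsetSum _ fun a ha => (hterm a ha).1,
    Finset.sum_congr rfl fun a ha => (hterm a ha).2, Finset.sum_const, nsmul_eq_mul,
    card_offDiag_range, ← mul_assoc, one_div, inv_mul_cancel₀ hpos.ne', one_mul]

/-- Chebyshev's inequality for a U-statistic. -/
lemma measure_le_abs_uStat_sub_le [IsProbabilityMeasure μ] (hY : ∀ i, Measurable (Y i))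
    (hind : iIndepFun Y P) (hlaw : ∀ i, P.map (Y i) = μ) {H : E × E → ℝ} (hH : Measurable H) {C D : ℝ} (hC0 : 0 ≤ C)
    (hD0 : 0 ≤ D) (hl : ∀ y, ∫⁻ y', ‖H (y, y')‖ₑ ∂μ ≤ ENNReal.ofReal C)
    (hr : ∀ y', ∫⁻ y, ‖H (y, y')‖ₑ ∂μ ≤ ENNReal.ofReal C)
    (hD : ∫⁻ u, ‖H u‖ₑ ^ 2 ∂(μ.prod μ) ≤ ENNReal.ofReal D) {n : ℕ} (hn : 2 ≤ n) {η : ℝ}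
    (hη : 0 < η) :
    P {ω | η ≤ |uStat n H (fun i => Y i ω) - ∫ u, H u ∂(μ.prod μ)|} ≤
      ENNReal.ofReal ((16 * C ^ 2 / n + 8 * (D / (n : ℝ) ^ 2)) / η ^ 2) := by
  have hn' : (2 : ℝ) ≤ n := by exact_mod_cast hn
  have hL2 : MemLp H 2 (μ.prod μ) := by
    refine ⟨hH.aestronglyMeasurable, ?_⟩
    rw [eLpNorm_lt_top_iff_lintegral_rpow_enorm_lt_top (by norm_num) (by norm_num)]
    have : ((2 : ℝ≥0∞).toReal) = ((2 : ℕ) : ℝ) := by simp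
    simp only [this, ENNReal.rpow_natCast]
    exact hD.trans_lt ENNReal.ofReal_lt_top
  have hmem : MemLp (fun ω => uStat n H (fun i => Y i ω)) 2 P := by
    have hterm : ∀ a ∈ (Finset.range n).offDiag,
        MemLp (fun ω => H (Y a.1 ω, Y a.2 ω)) 2 P := by
      intro a ha
      have hpm : Measurable fun ω => (Y a.1 ω, Y a.2 ω) := (hY a.1).prodMk (hY a.2)
      rw [← map_pair_eq_prod hY hind hlaw (Finset.mem_offDiag.1 ha).2.2] at hL2
      exact hL2.comp_of_map hpm.aemeasurable
    exact (memLp_finsetSum _ hterm).const_mul (1 / ((n : ℝ) * ((n : ℝ) - 1)))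
  rw [← integral_uStat hY hind hlaw (hL2.integrable one_le_two) hn]
  refine (meas_ge_le_variance_div_sq hmem hη).trans (ENNReal.ofReal_le_ofReal ?_)
  gcongr
  have hvar : Var[fun ω => uStat n H (fun i => Y i ω); P] =
      (1 / ((n : ℝ) * ((n : ℝ) - 1))) ^ 2 *
        Var[fun ω => ∑ a ∈ (Finset.range n).offDiag, H (Y a.1 ω, Y a.2 ω); P] :=
    variance_const_mul _ _ _
  rw [hvar]
  -- For `n ≥ 2` one has `n - 1 ≥ n / 2`; squaring gives the factor four, whence the constants 16
  -- and 8.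
  calc (1 / ((n : ℝ) * ((n : ℝ) - 1))) ^ 2 *
        Var[fun ω => ∑ a ∈ (Finset.range n).offDiag, H (Y a.1 ω, Y a.2 ω); P]
      ≤ (1 / ((n : ℝ) * ((n : ℝ) / 2))) ^ 2 * ((n : ℝ) ^ 2 * (4 * n * C ^ 2 + 2 * D)) := by
        gcongr
        · exact variance_nonneg _ _
        · exact one_div_nonneg.2 (by nlinarith)
        · linarith
        · exact variance_sum_offDiag_le hY hind hlaw hH hC0 hD0 hl hr hD n
    _ = 16 * C ^ 2 / n + 8 * (D / (n : ℝ) ^ 2) := by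
        field_simp
        ring

/-- Weak law of large numbers for a triangular array of U-statistics whose kernels can be
approximated in mean by kernels with bounded sections and controlled second moments. -/
theorem tendstoInMeasure_uStat [IsProbabilityMeasure μ] (hY : ∀ i, Measurable (Y i))
    (hind : iIndepFun Y P) (hlaw : ∀ i, P.map (Y i) = μ) {H : ℕ → E × E → ℝ} (hH : ∀ n, Measurable (H n)) {θ : ℝ}
    (happrox : ∀ δ > 0, ∃ (G : ℕ → E × E → ℝ) (C : ℝ) (D : ℕ → ℝ) (θ' : ℝ),
      (∀ n, Measurable (G n)) ∧ 0 ≤ C ∧ (∀ n, 0 ≤ D n) ∧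
      Tendsto (fun n => D n / (n : ℝ) ^ 2) atTop (𝓝 0) ∧
      (∀ᶠ n in atTop, (∀ y, ∫⁻ y', ‖G n (y, y')‖ₑ ∂μ ≤ ENNReal.ofReal C) ∧
        (∀ y', ∫⁻ y, ‖G n (y, y')‖ₑ ∂μ ≤ ENNReal.ofReal C) ∧
        ∫⁻ u, ‖G n u‖ₑ ^ 2 ∂(μ.prod μ) ≤ ENNReal.ofReal (D n) ∧
        ∫⁻ u, ‖H n u - G n u‖ₑ ∂(μ.prod μ) ≤ ENNReal.ofReal δ) ∧
      Tendsto (fun n => ∫ u, G n u ∂(μ.prod μ)) atTop (𝓝 θ') ∧ |θ' - θ| ≤ δ) :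
    TendstoInMeasure P (fun n ω => uStat n (H n) (fun i => Y i ω)) atTop (fun _ => θ) := by
  rw [tendstoInMeasure_iff_dist]
  intro η hη
  rw [ENNReal.tendsto_nhds_zero]
  intro ρ hρ
  obtain ⟨ρ', hρ'0, hρ'⟩ : ∃ r : ℝ, 0 < r ∧ ENNReal.ofReal r ≤ ρ := by
    rcases eq_or_ne ρ ∞ with rfl | hne
    · exact ⟨1, one_pos, le_top⟩
    · exact ⟨ρ.toReal, ENNReal.toReal_pos hρ.ne' hne, (ENNReal.ofReal_toReal hne).le⟩
  -- The distance to `θ` splits into four parts of size `η / 4`: approximation, fluctuation,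
  -- convergence of means, and `|θ' - θ|`. The second entry of the minimum makes Markov's inequality
  -- for the approximation part yield `ρ' / 2`.
  set δ : ℝ := min (η / 4) (η / 4 * (ρ' / 2)) with hδ
  have hδ0 : 0 < δ := by positivity
  obtain ⟨G, C, D, θ', hG, hC0, hD0, hDlim, hev, hmean, hθ⟩ := happrox δ hδ0
  have hvar : Tendsto (fun n : ℕ => (16 * C ^ 2 / n + 8 * (D n / (n : ℝ) ^ 2)) / (η / 4) ^ 2)
      atTop (𝓝 0) := by
    have h1 : Tendsto (fun n : ℕ => 16 * C ^ 2 / (n : ℝ)) atTop (𝓝 0) :=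
      tendsto_const_div_atTop_nhds_zero_nat _
    simpa using (h1.add (hDlim.const_mul 8)).div_const ((η / 4) ^ 2)
  have hvar' := hvar.eventually (gt_mem_nhds (show (0 : ℝ) < ρ' / 2 by positivity))
  have hmean' : ∀ᶠ n in atTop, |∫ u, G n u ∂(μ.prod μ) - θ'| < η / 4 := by
    have := Metric.tendsto_nhds.1 hmean (η / 4) (by positivity)
    simpa only [Real.dist_eq] using this
  filter_upwards [hev, hvar', hmean', eventually_ge_atTop 2] with n ⟨hl, hr, hD, hHG⟩ hv hm hn
  have hsub : {ω | η ≤ dist (uStat n (H n) (fun i => Y i ω)) θ} ⊆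
      {ω | ENNReal.ofReal (η / 4) ≤ ‖uStat n (H n - G n) (fun i => Y i ω)‖ₑ} ∪
      {ω | η / 4 ≤ |uStat n (G n) (fun i => Y i ω) - ∫ u, G n u ∂(μ.prod μ)|} := by
    intro ω hω
    by_contra hcon
    simp only [Set.mem_union, Set.mem_ofPred_eq, not_or, not_le] at hcon hω
    obtain ⟨h1, h2⟩ := hcon
    rw [← ofReal_norm, ENNReal.ofReal_lt_ofReal_iff (by positivity), Real.norm_eq_abs] at h1
    have h3 : uStat n (H n - G n) (fun i => Y i ω) =
        uStat n (H n) (fun i => Y i ω) - uStat n (G n) (fun i => Y i ω) := by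
      simp [uStat, Finset.sum_sub_distrib, mul_sub]
    rw [h3] at h1
    rw [Real.dist_eq] at hω
    have h4 : δ ≤ η / 4 := min_le_left _ _
    rw [abs_lt] at h1 h2 hm
    rw [abs_le] at hθ
    refine absurd hω (not_le.2 (abs_lt.2 ⟨?_, ?_⟩)) <;> linarith
  have hfirst : P {ω | ENNReal.ofReal (η / 4) ≤ ‖uStat n (H n - G n) (fun i => Y i ω)‖ₑ} ≤
      ENNReal.ofReal (ρ' / 2) := by
    refine (meas_ge_le_lintegral_div
      ((measurable_uStat hY ((hH n).sub (hG n)) n).enorm.aemeasurable)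
      (ENNReal.ofReal_pos.2 (by positivity)).ne' ENNReal.ofReal_ne_top).trans ?_
    refine ENNReal.div_le_of_le_mul ?_
    rw [← ENNReal.ofReal_mul (by positivity), mul_comm]
    exact ((lintegral_enorm_uStat_le hY hind hlaw ((hH n).sub (hG n)) hn).trans hHG).trans
      (ENNReal.ofReal_le_ofReal (min_le_right _ _))
  have hsecond := measure_le_abs_uStat_sub_le hY hind hlaw (hG n) hC0 (hD0 n) hl hr hD hn
    (show 0 < η / 4 by positivity)
  calc P {ω | η ≤ dist (uStat n (H n) (fun i => Y i ω)) θ}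
      ≤ ENNReal.ofReal (ρ' / 2) + ENNReal.ofReal (ρ' / 2) :=
        (measure_mono hsub).trans ((measure_union_le _ _).trans
          (add_le_add hfirst (hsecond.trans (ENNReal.ofReal_le_ofReal hv.le))))
    _ = ENNReal.ofReal ρ' := by
        rw [← ENNReal.ofReal_add (by positivity) (by positivity), add_halves]
    _ ≤ ρ := hρ'

end UStatistic

/-! ### Rescaled kernels -/

section Scaled

variable {p : ℕ} {K : Vec p → ℝ} {h : ℝ}

lemma measurable_scaled (hK : Measurable K) (h : ℝ) : Measurable (scaled K h) :=
  (hK.comp (measurable_const_smul h⁻¹)).div_const _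

/-- The integral of a non-integrable function is zero by convention, so integral one entails
integrability. -/
lemma IsKernelOfOrder.integrable {m : ℕ} (hK : IsKernelOfOrder K m) : Integrable K :=
  Integrable.of_integral_ne_zero (by rw [hK.integral_eq_one]; exact one_ne_zero)

lemma scaled_ne_zero_norm_le {R : ℝ} (hR : ∀ t, K t ≠ 0 → ‖t‖ ≤ R) (hh : 0 < h) {z : Vec p}
    (hz : scaled K h z ≠ 0) : ‖z‖ ≤ h * R := by
  have h1 : K (h⁻¹ • z) ≠ 0 := fun h0 => hz (by simp [scaled, h0])
  have h2 := hR _ h1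
  rw [norm_smul, norm_inv, Real.norm_of_nonneg hh.le, inv_mul_le_iff₀ hh] at h2
  exact h2

/-- Translation and dilation in a Lebesgue integral over `ℝ^p`. -/
lemma integral_eq_mul_integral_sub_smul (hh : 0 < h) (x : Vec p) (G : Vec p → ℝ) :
    ∫ y, G y = h ^ p * ∫ t, G (x - h • t) := by
  rw [← integral_sub_left_eq_self G volume x,
    Measure.integral_comp_smul volume (fun t => G (x - t)) h, finrank_euclideanSpace_fin,
    abs_of_nonneg (by positivity), smul_eq_mul, ← mul_assoc, mul_inv_cancel₀ (by positivity),
    one_mul]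

lemma lintegral_comp_inv_smul (hh : 0 < h) {G : Vec p → ℝ≥0∞} (hG : Measurable G) :
    ∫⁻ z, G (h⁻¹ • z) = ENNReal.ofReal (h ^ p) * ∫⁻ t, G t := by
  rw [← lintegral_map hG (measurable_const_smul h⁻¹),
    Measure.map_addHaar_smul volume (inv_ne_zero hh.ne'), lintegral_smul_measure,
    finrank_euclideanSpace_fin, inv_pow, inv_inv, abs_of_nonneg (by positivity), smul_eq_mul]

lemma lintegral_enorm_scaled (hK : Measurable K) (hh : 0 < h) :
    ∫⁻ z, ‖scaled K h z‖ₑ = ∫⁻ t, ‖K t‖ₑ := by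
  have hp : 0 < h ^ p := by positivity
  have h1 : ∀ z, ‖scaled K h z‖ₑ = ENNReal.ofReal (h ^ p)⁻¹ * ‖K (h⁻¹ • z)‖ₑ := fun z => by
    rw [scaled, div_eq_inv_mul, enorm_mul, Real.enorm_of_nonneg (by positivity)]
  simp only [h1]
  rw [lintegral_const_mul' _ _ ENNReal.ofReal_ne_top,
    lintegral_comp_inv_smul hh (G := fun t => ‖K t‖ₑ) hK.enorm, ← mul_assoc,
    ← ENNReal.ofReal_mul (by positivity), inv_mul_cancel₀ hp.ne', ENNReal.ofReal_one, one_mul]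

lemma lintegral_enorm_scaled_sq (hK : Measurable K) (hh : 0 < h) :
    ∫⁻ z, ‖scaled K h z‖ₑ ^ 2 = ENNReal.ofReal (h ^ p)⁻¹ * ∫⁻ t, ‖K t‖ₑ ^ 2 := by
  have hp : 0 < h ^ p := by positivity
  have h1 : ∀ z, ‖scaled K h z‖ₑ ^ 2 =
      ENNReal.ofReal (h ^ p)⁻¹ ^ 2 * ‖K (h⁻¹ • z)‖ₑ ^ 2 := fun z => by
    rw [scaled, div_eq_inv_mul, enorm_mul, Real.enorm_of_nonneg (by positivity), mul_pow]
  simp only [h1]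
  rw [lintegral_const_mul' _ _ (by finiteness),
    lintegral_comp_inv_smul hh (G := fun t => ‖K t‖ₑ ^ 2) (hK.enorm.pow_const 2), ← mul_assoc,
    pow_two, mul_assoc (ENNReal.ofReal _), ← ENNReal.ofReal_mul (by positivity),
    inv_mul_cancel₀ hp.ne', ENNReal.ofReal_one, mul_one]

end Scaled

/-! ### Conditioning a pair of observations on its covariates -/

section PairLaw

variable {p : ℕ}

lemma measurableSet_concordant : MeasurableSet {u : (ℝ × ℝ) × (ℝ × ℝ) | Concordant u.1 u.2} :=
  measurableSet_lt measurable_const (by fun_prop)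

lemma measurable_prob2 (κ : Kernel (Vec p) (ℝ × ℝ)) [IsMarkovKernel κ] :
    Measurable fun v : Vec p × Vec p => prob2 κ v.1 v.2 := by
  have := ((κ ∥ₖ κ).measurable_coe measurableSet_concordant).ennreal_toReal
  simpa only [Kernel.parallelComp_apply, prob2, measureReal_def] using this

lemma prob2_nonneg (κ : Kernel (Vec p) (ℝ × ℝ)) (x y : Vec p) : 0 ≤ prob2 κ x y :=
  measureReal_nonneg

lemma prob2_le_one (κ : Kernel (Vec p) (ℝ × ℝ)) [IsMarkovKernel κ] (x y : Vec p) :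
    prob2 κ x y ≤ 1 :=
  measureReal_le_one

/-- For two independent copies of `(Z, X)`, the conditional law of `(X₁, X₂)` given `(Z₁, Z₂)`. -/
lemma map_prod_compProd_eq (ν : Measure (Vec p)) [SFinite ν] (κ : Kernel (Vec p) (ℝ × ℝ))
    [IsMarkovKernel κ] :
    ((ν ⊗ₘ κ).prod (ν ⊗ₘ κ)).map (fun u => ((u.1.1, u.2.1), (u.1.2, u.2.2))) =
      (ν.prod ν) ⊗ₘ (κ ∥ₖ κ) := by
  refine Measure.ext_of_lintegral _ fun F hF => ?_
  rw [lintegral_map hF (by fun_prop), lintegral_prod _ (by fun_prop),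
    Measure.lintegral_compProd (by fun_prop), Measure.lintegral_compProd hF,
    lintegral_prod _ hF.lintegral_kernel_prod_right'.aemeasurable]
  refine lintegral_congr fun z => ?_
  have h1 : ∀ x : ℝ × ℝ, ∫⁻ y, F ((z, y.1), (x, y.2)) ∂(ν ⊗ₘ κ) =
      ∫⁻ z', ∫⁻ x', F ((z, z'), (x, x')) ∂κ z' ∂ν := fun x =>
    Measure.lintegral_compProd (by fun_prop)
  simp only [h1]
  rw [lintegral_lintegral_swap]
  · refine lintegral_congr fun z' => ?_
    rw [Kernel.parallelComp_apply, lintegral_prod _ (by fun_prop)]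
  · refine Measurable.aemeasurable ?_
    exact Measurable.lintegral_kernel_prod_right' (κ := κ.comap Prod.snd measurable_snd)
      (f := fun v : ((ℝ × ℝ) × Vec p) × (ℝ × ℝ) => F ((z, v.1.2), (v.1.1, v.2))) (by fun_prop)

open Classical in
/-- The summand of a localized log-likelihood: `a z` is the contribution of a concordant pair, and
`c z` the contribution of a pair that is not concordant. -/
noncomputable def pairKer (K : Vec p → ℝ) (h : ℝ) (a c : Vec p → ℝ)
    (u : (Vec p × (ℝ × ℝ)) × (Vec p × (ℝ × ℝ))) : ℝ :=
  scaled K h (u.1.1 - u.2.1) * if Concordant u.1.2 u.2.2 then a u.1.1 else c u.1.1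

/-- The conditional expectation of the contribution of a pair given `Z₁ = x, Z₂ = y`. -/
noncomputable def mix (κ : Kernel (Vec p) (ℝ × ℝ)) (a c : Vec p → ℝ) (x y : Vec p) : ℝ :=
  prob2 κ x y * a x + (1 - prob2 κ x y) * c x

variable {K : Vec p → ℝ} {h : ℝ} {a c : Vec p → ℝ} {κ : Kernel (Vec p) (ℝ × ℝ)}

lemma measurable_pairKer (hK : Measurable K) (ha : Measurable a) (hc : Measurable c) :
    Measurable (pairKer K h a c) := by
  have hs := measurable_scaled hK h
  refine Measurable.mul (by fun_prop) (Measurable.ite ?_ (by fun_prop) (by fun_prop))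
  exact measurableSet_concordant.preimage (f := fun u : (Vec p × (ℝ × ℝ)) × (Vec p × (ℝ × ℝ)) =>
    (u.1.2, u.2.2)) (by fun_prop)

lemma measurable_mix [IsMarkovKernel κ] (ha : Measurable a) (hc : Measurable c) :
    Measurable fun v : Vec p × Vec p => mix κ a c v.1 v.2 := by
  have := measurable_prob2 κ
  unfold mix
  fun_prop

lemma abs_mix_le [IsMarkovKernel κ] {k : ℝ} (ha : ∀ x, |a x| ≤ k) (hc : ∀ x, |c x| ≤ k)
    (x y : Vec p) : |mix κ a c x y| ≤ k := by
  have h0 := prob2_nonneg κ x y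
  have h1 := prob2_le_one κ x y
  have h2 := abs_le.1 (ha x)
  have h3 := abs_le.1 (hc x)
  rw [mix, abs_le]
  constructor <;> nlinarith

open Classical in
lemma integral_ite_concordant [IsMarkovKernel κ] (x y : Vec p) (s t : ℝ) :
    ∫ w, (if Concordant w.1 w.2 then s else t) ∂((κ x).prod (κ y)) =
      prob2 κ x y * s + (1 - prob2 κ x y) * t := by
  have h1 : (fun w : (ℝ × ℝ) × (ℝ × ℝ) => if Concordant w.1 w.2 then s else t) =
      fun w => Set.indicator {w | Concordant w.1 w.2} (fun _ => s - t) w + t := by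
    funext w
    by_cases hw : Concordant w.1 w.2 <;> simp [hw]
  rw [h1, integral_add ((integrable_const _).indicator measurableSet_concordant)
    (integrable_const _), integral_indicator_const _ measurableSet_concordant]
  simp only [integral_const, probReal_univ, smul_eq_mul, prob2]
  ring

/-- Since `a` and `c` have the same sign, the conditional mean of the absolute value is the absolute
value of the conditional mean. Hence an equality, and bounds on `mix` alone control the L¹ norm. -/
lemma lintegral_enorm_pairKer (ν : Measure (Vec p)) [SFinite ν] [IsMarkovKernel κ]
    (hK : Measurable K) (ha : Measurable a) (hc : Measurable c) (ha0 : ∀ x, a x ≤ 0)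
    (hc0 : ∀ x, c x ≤ 0) :
    ∫⁻ u, ‖pairKer K h a c u‖ₑ ∂((ν ⊗ₘ κ).prod (ν ⊗ₘ κ)) =
      ∫⁻ x, ∫⁻ y, ‖scaled K h (x - y)‖ₑ * ‖mix κ a c x y‖ₑ ∂ν ∂ν := by
  classical
  have hs := measurable_scaled hK h
  set F : (Vec p × Vec p) × ((ℝ × ℝ) × (ℝ × ℝ)) → ℝ := fun v =>
    scaled K h (v.1.1 - v.1.2) * if Concordant v.2.1 v.2.2 then a v.1.1 else c v.1.1 with hF
  have hFm : Measurable F := by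
    refine Measurable.mul (by fun_prop) (Measurable.ite ?_ (by fun_prop) (by fun_prop))
    exact measurableSet_concordant.preimage measurable_snd
  have h1 : ∫⁻ u, ‖pairKer K h a c u‖ₑ ∂((ν ⊗ₘ κ).prod (ν ⊗ₘ κ)) =
      ∫⁻ v, ‖F v‖ₑ ∂((ν.prod ν) ⊗ₘ (κ ∥ₖ κ)) := by
    rw [← map_prod_compProd_eq, lintegral_map hFm.enorm (by fun_prop)]
    rfl
  rw [h1, Measure.lintegral_compProd hFm.enorm,
    lintegral_prod _ hFm.enorm.lintegral_kernel_prod_right'.aemeasurable]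
  refine lintegral_congr fun x => lintegral_congr fun y => ?_
  simp only [hF, enorm_mul]
  rw [lintegral_const_mul' _ _ (by finiteness), Kernel.parallelComp_apply]
  congr 1
  have h2 : ∀ w : (ℝ × ℝ) × (ℝ × ℝ), ‖if Concordant w.1 w.2 then a x else c x‖ₑ =
      ENNReal.ofReal (if Concordant w.1 w.2 then -a x else -c x) := fun w => by
    rw [← ofReal_norm, Real.norm_eq_abs]
    split_ifs
    · rw [abs_of_nonpos (ha0 x)]
    · rw [abs_of_nonpos (hc0 x)]
  simp only [h2]
  rw [← ofReal_integral_eq_lintegral_ofReal, integral_ite_concordant, ← ofReal_norm,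
    Real.norm_eq_abs, abs_of_nonpos, mix]
  · congr 1
    ring
  · have h3 := prob2_nonneg κ x y
    have h4 := prob2_le_one κ x y
    have := ha0 x
    have := hc0 x
    rw [mix]
    nlinarith
  · exact Integrable.of_bound
      (Measurable.ite measurableSet_concordant measurable_const measurable_const).aestronglyMeasurable
      (max |a x| |c x|) (ae_of_all _ fun w => by split_ifs <;> simp)
  · refine ae_of_all _ fun w => ?_
    dsimp only
    split_ifs
    · simpa using ha0 x
    · simpa using hc0 x

lemma integral_pairKer (ν : Measure (Vec p)) [SFinite ν] [IsMarkovKernel κ]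
    (hK : Measurable K) (ha : Measurable a) (hc : Measurable c)
    (hint : Integrable (pairKer K h a c) ((ν ⊗ₘ κ).prod (ν ⊗ₘ κ))) :
    ∫ u, pairKer K h a c u ∂((ν ⊗ₘ κ).prod (ν ⊗ₘ κ)) =
      ∫ x, ∫ y, scaled K h (x - y) * mix κ a c x y ∂ν ∂ν := by
  classical
  have hs := measurable_scaled hK h
  set F : (Vec p × Vec p) × ((ℝ × ℝ) × (ℝ × ℝ)) → ℝ := fun v =>
    scaled K h (v.1.1 - v.1.2) * if Concordant v.2.1 v.2.2 then a v.1.1 else c v.1.1 with hF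
  have hFm : Measurable F := by
    refine Measurable.mul (by fun_prop) (Measurable.ite ?_ (by fun_prop) (by fun_prop))
    exact measurableSet_concordant.preimage measurable_snd
  have hFint : Integrable F ((ν.prod ν) ⊗ₘ (κ ∥ₖ κ)) := by
    rw [← map_prod_compProd_eq, integrable_map_measure hFm.aestronglyMeasurable (by fun_prop)]
    exact hint
  have h1 : ∫ u, pairKer K h a c u ∂((ν ⊗ₘ κ).prod (ν ⊗ₘ κ)) =
      ∫ v, F v ∂((ν.prod ν) ⊗ₘ (κ ∥ₖ κ)) := by
    rw [← map_prod_compProd_eq, integral_map (by fun_prop) hFm.aestronglyMeasurable]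
    rfl
  have h2 : ∀ v : Vec p × Vec p, ∫ w, F (v, w) ∂((κ ∥ₖ κ) v) =
      scaled K h (v.1 - v.2) * mix κ a c v.1 v.2 := fun v => by
    simp only [hF]
    rw [integral_const_mul, Kernel.parallelComp_apply, integral_ite_concordant, mix]
  have h3 : Integrable (fun v : Vec p × Vec p => scaled K h (v.1 - v.2) * mix κ a c v.1 v.2)
      (ν.prod ν) := by
    have := hFint.integral_compProd
    simpa only [Kernel.prodMkLeft_apply, Kernel.const_apply, h2] using this
  rw [h1, Measure.integral_compProd hFint]
  simp only [h2]
  rw [integral_prod _ h3]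

end PairLaw

/-- A function of finite (lower) integral has a measurable minorant of finite integral that
dominates almost everywhere all its measurable minorants. -/
lemma exists_measurable_forall_le_ae {α : Type*} [MeasurableSpace α] {μ : Measure α}
    {Φ : α → ℝ≥0∞} (hΦ : ∫⁻ x, Φ x ∂μ ≠ ∞) :
    ∃ Ψ : α → ℝ≥0∞, Measurable Ψ ∧ ∫⁻ x, Ψ x ∂μ ≠ ∞ ∧
      ∀ g : α → ℝ≥0∞, Measurable g → g ≤ Φ → g ≤ᵐ[μ] Ψ := by
  obtain ⟨Ψ, hΨm, hΨ, hint⟩ := exists_measurable_le_lintegral_eq μ Φ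
  refine ⟨Ψ, hΨm, hint ▸ hΦ, fun g hg hgΦ => ?_⟩
  -- The maximum is again a measurable minorant of `Φ`, so its integral cannot exceed that of `Ψ`,
  -- which already attains the lower integral.
  have h1 : Ψ =ᵐ[μ] fun x => max (g x) (Ψ x) :=
    ae_eq_of_ae_le_of_lintegral_le (ae_of_all _ fun x => le_max_right _ _) (hint ▸ hΦ)
      (hg.max hΨm).aemeasurable (hint ▸ lintegral_mono fun x => max_le (hgΦ x) (hΨ x))
  filter_upwards [h1] with x hx
  rw [hx]
  exact le_max_left _ _

/-! ### Sections and second moments of truncated kernels -/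

section Bounds

variable {p : ℕ} {K : Vec p → ℝ} {f : Vec p → ℝ} {a c : Vec p → ℝ}
  {κ : Kernel (Vec p) (ℝ × ℝ)} [IsMarkovKernel κ] {h k r M R : ℝ}

lemma lintegral_compProd_fst (ν : Measure (Vec p)) [SFinite ν] {G : Vec p → ℝ≥0∞}
    (hG : Measurable G) : ∫⁻ y, G y.1 ∂(ν ⊗ₘ κ) = ∫⁻ z, G z ∂ν := by
  rw [Measure.lintegral_compProd (by fun_prop)]
  simp

lemma lintegral_sub_right_withDensity_le (hf : Measurable f) {w : Vec p → ℝ≥0∞} (hw : Measurable w)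
    (hw1 : ∀ z, w z ≠ 0 → ‖z‖ ≤ 1) (hM : ∀ z, ‖z‖ ≤ r + 1 → f z ≤ M) {x : Vec p} (hx : ‖x‖ ≤ r) :
    ∫⁻ y, w (x - y) ∂(volume.withDensity fun z => ENNReal.ofReal (f z)) ≤
      ENNReal.ofReal M * ∫⁻ z, w z := by
  rw [lintegral_withDensity_eq_lintegral_mul _ (by fun_prop) (by fun_prop),
    ← lintegral_sub_left_eq_self w x, ← lintegral_const_mul' _ _ ENNReal.ofReal_ne_top]
  refine lintegral_mono fun y => ?_
  simp only [Pi.mul_apply]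
  rcases eq_or_ne (w (x - y)) 0 with h0 | h0
  · simp [h0]
  · gcongr
    refine hM _ ?_
    have h1 := hw1 _ h0
    have h2 := norm_sub_norm_le y x
    rw [norm_sub_rev] at h2
    linarith

lemma lintegral_sub_left_withDensity_le (hf : Measurable f) {w : Vec p → ℝ≥0∞} (hw : Measurable w)
    (hM : ∀ z, ‖z‖ ≤ r → f z ≤ M) (y : Vec p) :
    ∫⁻ x, (Metric.closedBall 0 r).indicator (fun x => w (x - y)) x
        ∂(volume.withDensity fun z => ENNReal.ofReal (f z)) ≤
      ENNReal.ofReal M * ∫⁻ z, w z := by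
  rw [lintegral_withDensity_eq_lintegral_mul _ (by fun_prop)
    (Measurable.indicator (by fun_prop) measurableSet_closedBall),
    ← lintegral_sub_right_eq_self w y, ← lintegral_const_mul' _ _ ENNReal.ofReal_ne_top]
  refine lintegral_mono fun x => ?_
  simp only [Pi.mul_apply]
  by_cases hx : x ∈ Metric.closedBall (0 : Vec p) r
  · rw [Set.indicator_of_mem hx]
    gcongr
    exact hM _ (by simpa using hx)
  · simp [Set.indicator_of_notMem hx]

lemma enorm_pairKer_le (ha : ∀ x, |a x| ≤ k) (hc : ∀ x, |c x| ≤ k)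
    (har : ∀ x, r < ‖x‖ → a x = 0) (hcr : ∀ x, r < ‖x‖ → c x = 0)
    (u : (Vec p × (ℝ × ℝ)) × (Vec p × (ℝ × ℝ))) :
    ‖pairKer K h a c u‖ₑ ≤ ENNReal.ofReal k *
      (Metric.closedBall 0 r).indicator (fun x => ‖scaled K h (x - u.2.1)‖ₑ) u.1.1 := by
  classical
  rw [pairKer, enorm_mul, mul_comm]
  by_cases hx : u.1.1 ∈ Metric.closedBall (0 : Vec p) r
  · rw [Set.indicator_of_mem hx]
    gcongr
    rw [← ofReal_norm, Real.norm_eq_abs]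
    refine ENNReal.ofReal_le_ofReal ?_
    split_ifs
    exacts [ha _, hc _]
  · have hx' : r < ‖u.1.1‖ := by simpa using hx
    simp [har _ hx', hcr _ hx']

/-- Truncation confines only the first location, to radius `r`. The second is within `h * R ≤ 1` of
it by the support of `K`, which is why the density is bounded on radius `r + 1`. -/
lemma lintegral_enorm_pairKer_right_le [SFinite (volume.withDensity fun z => ENNReal.ofReal (f z))]
    (hK : Measurable K) (hf : Measurable f) (hh : 0 < h)
    (hR : ∀ t, K t ≠ 0 → ‖t‖ ≤ R) (hhR : h * R ≤ 1) (hM : ∀ z, ‖z‖ ≤ r + 1 → f z ≤ M)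
    (ha : ∀ x, |a x| ≤ k) (hc : ∀ x, |c x| ≤ k)
    (har : ∀ x, r < ‖x‖ → a x = 0) (hcr : ∀ x, r < ‖x‖ → c x = 0) (y : Vec p × (ℝ × ℝ)) :
    ∫⁻ y', ‖pairKer K h a c (y, y')‖ₑ
        ∂((volume.withDensity fun z => ENNReal.ofReal (f z)) ⊗ₘ κ) ≤
      ENNReal.ofReal k * (ENNReal.ofReal M * ∫⁻ t, ‖K t‖ₑ) := by
  have hs := measurable_scaled hK h
  refine (lintegral_mono fun y' => enorm_pairKer_le ha hc har hcr (y, y')).trans ?_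
  rw [lintegral_const_mul' _ _ ENNReal.ofReal_ne_top]
  gcongr
  dsimp only
  by_cases hy : y.1 ∈ Metric.closedBall (0 : Vec p) r
  · simp only [Set.indicator_of_mem hy]
    rw [lintegral_compProd_fst _ (G := fun z => ‖scaled K h (y.1 - z)‖ₑ) (by fun_prop),
      ← lintegral_enorm_scaled hK hh]
    exact lintegral_sub_right_withDensity_le hf (w := fun z => ‖scaled K h z‖ₑ) (by fun_prop)
      (fun z hz => (scaled_ne_zero_norm_le hR hh (by simpa using hz)).trans hhR) hM
      (by simpa using hy)
  · simp [Set.indicator_of_notMem hy]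

lemma lintegral_enorm_pairKer_left_le [SFinite (volume.withDensity fun z => ENNReal.ofReal (f z))]
    (hK : Measurable K) (hf : Measurable f) (hh : 0 < h) (hM : ∀ z, ‖z‖ ≤ r → f z ≤ M)
    (ha : ∀ x, |a x| ≤ k) (hc : ∀ x, |c x| ≤ k)
    (har : ∀ x, r < ‖x‖ → a x = 0) (hcr : ∀ x, r < ‖x‖ → c x = 0) (y' : Vec p × (ℝ × ℝ)) :
    ∫⁻ y, ‖pairKer K h a c (y, y')‖ₑ
        ∂((volume.withDensity fun z => ENNReal.ofReal (f z)) ⊗ₘ κ) ≤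
      ENNReal.ofReal k * (ENNReal.ofReal M * ∫⁻ t, ‖K t‖ₑ) := by
  have hs := measurable_scaled hK h
  refine (lintegral_mono fun y => enorm_pairKer_le ha hc har hcr (y, y')).trans ?_
  rw [lintegral_const_mul' _ _ ENNReal.ofReal_ne_top]
  gcongr
  rw [lintegral_compProd_fst _ (G := (Metric.closedBall 0 r).indicator
    (fun x => ‖scaled K h (x - y'.1)‖ₑ)) (Measurable.indicator (by fun_prop)
      measurableSet_closedBall), ← lintegral_enorm_scaled hK hh]
  exact lintegral_sub_left_withDensity_le hf (w := fun z => ‖scaled K h z‖ₑ) (by fun_prop) hM y'.1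

/-- The same localization applied to the squared kernel; the dilation now leaves a factor `(h ^
p)⁻¹`, the source of the condition on `n² h^p`. -/
lemma lintegral_enorm_pairKer_sq_le
    [IsProbabilityMeasure (volume.withDensity fun z => ENNReal.ofReal (f z))]
    (hK : Measurable K) (hf : Measurable f) (hh : 0 < h)
    (hR : ∀ t, K t ≠ 0 → ‖t‖ ≤ R) (hhR : h * R ≤ 1) (hM : ∀ z, ‖z‖ ≤ r + 1 → f z ≤ M)
    (ha : ∀ x, |a x| ≤ k) (hc : ∀ x, |c x| ≤ k) (ham : Measurable a)
    (hcm : Measurable c) (har : ∀ x, r < ‖x‖ → a x = 0) (hcr : ∀ x, r < ‖x‖ → c x = 0) :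
    ∫⁻ u, ‖pairKer K h a c u‖ₑ ^ 2
        ∂(((volume.withDensity fun z => ENNReal.ofReal (f z)) ⊗ₘ κ).prod
          ((volume.withDensity fun z => ENNReal.ofReal (f z)) ⊗ₘ κ)) ≤
      ENNReal.ofReal k ^ 2 * (ENNReal.ofReal M *
        (ENNReal.ofReal (h ^ p)⁻¹ * ∫⁻ t, ‖K t‖ₑ ^ 2)) := by
  have hs := measurable_scaled hK h
  rw [lintegral_prod _ ((measurable_pairKer hK ham hcm).enorm.pow_const 2).aemeasurable]
  refine (lintegral_mono (g := fun _ => ENNReal.ofReal k ^ 2 * (ENNReal.ofReal M *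
        (ENNReal.ofReal (h ^ p)⁻¹ * ∫⁻ t, ‖K t‖ₑ ^ 2))) fun y => ?_).trans (by simp)
  refine (lintegral_mono fun y' => pow_le_pow_left' (enorm_pairKer_le ha hc har hcr (y, y'))
    2).trans ?_
  simp only [mul_pow]
  rw [lintegral_const_mul' _ _ (by finiteness)]
  gcongr
  by_cases hy : y.1 ∈ Metric.closedBall (0 : Vec p) r
  · simp only [Set.indicator_of_mem hy]
    rw [lintegral_compProd_fst _ (G := fun z => ‖scaled K h (y.1 - z)‖ₑ ^ 2) (by fun_prop),
      ← lintegral_enorm_scaled_sq hK hh]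
    exact lintegral_sub_right_withDensity_le hf (w := fun z => ‖scaled K h z‖ₑ ^ 2) (by fun_prop)
      (fun z hz => (scaled_ne_zero_norm_le hR hh (by simpa using hz)).trans hhR) hM
      (by simpa using hy)
  · simp [Set.indicator_of_notMem hy]

end Bounds

/-! ### Convergence of the mean of the truncated criterion -/

section Mean

variable {p : ℕ} {K : Vec p → ℝ} {f : Vec p → ℝ} {a c : Vec p → ℝ}
  {κ : Kernel (Vec p) (ℝ × ℝ)} [IsMarkovKernel κ] {k r M R : ℝ}

lemma ae_sub_smul {h : ℝ} (hh : h ≠ 0) (x : Vec p) {Q : Vec p → Prop} (hQ : ∀ᵐ z, Q z) :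
    ∀ᵐ t : Vec p, Q (x - h • t) := by
  have h1 : Measure.QuasiMeasurePreserving (fun t : Vec p => h • t) volume volume :=
    ⟨measurable_const_smul h, by
      rw [Measure.map_addHaar_smul volume hh]
      exact Measure.smul_absolutelyContinuous⟩
  have h2 := (Measure.measurePreserving_sub_left (volume : Measure (Vec p)) x).quasiMeasurePreserving
  exact (h2.comp h1).ae hQ

lemma integral_scaled_mul_withDensity {h : ℝ} (hf0 : ∀ z, 0 ≤ f z) (hf : Measurable f)
    (hh : 0 < h) (x : Vec p) (G : Vec p → ℝ) :
    ∫ y, scaled K h (x - y) * G y ∂(volume.withDensity fun z => ENNReal.ofReal (f z)) =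
      ∫ t, K t * (G (x - h • t) * f (x - h • t)) := by
  rw [integral_withDensity_eq_integral_toReal_smul (by fun_prop)
    (ae_of_all _ fun _ => ENNReal.ofReal_lt_top), integral_eq_mul_integral_sub_smul hh x,
    ← integral_const_mul]
  refine integral_congr_ae (ae_of_all _ fun t => ?_)
  simp only [sub_sub_cancel, scaled, smul_smul, inv_mul_cancel₀ hh.ne', one_smul, smul_eq_mul,
    ENNReal.toReal_ofReal (hf0 _)]
  have : h ^ p ≠ 0 := by positivity
  field_simp

/-- The bias of the localized criterion vanishes, for bounded contributions of bounded support. -/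
lemma tendsto_integral_scaled_mul_mix
    [IsFiniteMeasure (volume.withDensity fun z => ENNReal.ofReal (f z))] {m : ℕ}
    (hK : IsKernelOfOrder K m) (hR : ∀ t, K t ≠ 0 → ‖t‖ ≤ R)
    (hf0 : ∀ z, 0 ≤ f z) (hf : Continuous f) {S : Set (Vec p)} (hfS : ∀ᵐ z, f z ≠ 0 → z ∈ S)
    {h : ℕ → ℝ} (hpos : ∀ n, 0 < h n) (hzero : Tendsto h atTop (𝓝 0))
    (hM : ∀ z, ‖z‖ ≤ r + 1 → f z ≤ M)
    (ha : ∀ x, |a x| ≤ k) (hc : ∀ x, |c x| ≤ k) (ham : Measurable a)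
    (hcm : Measurable c) (har : ∀ x, r < ‖x‖ → a x = 0) (hcr : ∀ x, r < ‖x‖ → c x = 0)
    (hcont : ∀ x ∈ S, ContinuousOn (mix κ a c x) S) :
    Tendsto (fun n => ∫ x, ∫ y, scaled K (h n) (x - y) * mix κ a c x y
        ∂(volume.withDensity fun z => ENNReal.ofReal (f z))
        ∂(volume.withDensity fun z => ENNReal.ofReal (f z))) atTop
      (𝓝 (∫ x, mix κ a c x x * f x ∂(volume.withDensity fun z => ENNReal.ofReal (f z)))) := by
  have hKm := hK.measurable
  have hfm := hf.measurable
  have hmixm := measurable_mix (κ := κ) ham hcm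
  simp only [integral_scaled_mul_withDensity hf0 hfm (hpos _)]
  have hhR : ∀ᶠ n in atTop, h n * R ≤ 1 := by
    have : Tendsto (fun n => h n * R) atTop (𝓝 0) := by simpa using hzero.mul_const R
    exact this.eventually (ge_mem_nhds zero_lt_one)
  have hbound : ∀ n, h n * R ≤ 1 → ∀ x t, ‖K t * (mix κ a c x (x - h n • t) * f (x - h n • t))‖ ≤
      |K t| * (k * |M|) := by
    intro n hn x t
    rw [norm_mul, norm_mul, Real.norm_eq_abs, Real.norm_eq_abs, Real.norm_eq_abs]
    have hk : 0 ≤ k := (abs_nonneg _).trans (ha x)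
    rcases eq_or_ne (K t) 0 with h0 | h0
    · simp [h0]
    rcases lt_or_ge r ‖x‖ with hx | hx
    · simp only [mix, har x hx, hcr x hx, mul_zero, add_zero, abs_zero, zero_mul]
      positivity
    · gcongr
      · exact abs_mix_le ha hc _ _
      · exact hf0 _
      · refine hM _ ?_
        calc ‖x - h n • t‖ ≤ ‖x‖ + ‖h n • t‖ := norm_sub_le _ _
          _ ≤ r + h n * R := by
            rw [norm_smul, Real.norm_of_nonneg (hpos n).le]
            exact add_le_add hx (mul_le_mul_of_nonneg_left (hR t h0) (hpos n).le)
          _ ≤ r + 1 := by linarith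
  have hKint : Integrable fun t => |K t| * (k * |M|) := hK.integrable.abs.mul_const _
  have hae : ∀ᵐ x ∂(volume.withDensity fun z => ENNReal.ofReal (f z)), f x ≠ 0 ∧ x ∈ S := by
    rw [ae_withDensity_iff (by fun_prop)]
    filter_upwards [hfS] with z hz hfz
    have : f z ≠ 0 := fun h0 => hfz (by simp [h0])
    exact ⟨this, hz this⟩
  refine tendsto_integral_filter_of_dominated_convergence (fun _ => ∫ t, |K t| * (k * |M|))
    (Eventually.of_forall fun n => ?_) ?_ (integrable_const _) ?_
  · refine (StronglyMeasurable.integral_prod_right' (f := fun v : Vec p × Vec p =>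
      K v.2 * (mix κ a c v.1 (v.1 - h n • v.2) * f (v.1 - h n • v.2))) ?_).aestronglyMeasurable
    refine Measurable.stronglyMeasurable ?_
    have := hmixm.comp (g := fun v : Vec p × Vec p => mix κ a c v.1 v.2)
      (f := fun v : Vec p × Vec p => (v.1, v.1 - h n • v.2)) (by fun_prop)
    exact Measurable.mul (by fun_prop) (Measurable.mul this (by fun_prop))
  · filter_upwards [hhR] with n hn
    refine ae_of_all _ fun x => ?_
    exact norm_integral_le_of_norm_le hKint (ae_of_all _ fun t => hbound n hn x t)
  · filter_upwards [hae] with x ⟨hx0, hxS⟩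
    have hlim : ∫ t, K t * (mix κ a c x x * f x) = mix κ a c x x * f x := by
      rw [integral_mul_const, hK.integral_eq_one, one_mul]
    rw [← hlim]
    refine tendsto_integral_filter_of_dominated_convergence (fun t => |K t| * (k * |M|))
      (Eventually.of_forall fun n => ?_) ?_ hKint ?_
    · have h1 := hmixm.comp (g := fun v : Vec p × Vec p => mix κ a c v.1 v.2)
        (f := fun t : Vec p => (x, x - h n • t)) (by fun_prop)
      exact (Measurable.mul (by fun_prop) (Measurable.mul h1 (by fun_prop))).aestronglyMeasurable
    · filter_upwards [hhR] with n hn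
      exact ae_of_all _ fun t => hbound n hn x t
    -- Continuity of `mix` is available only on `S`. As `f x ≠ 0` and `f` is continuous, `f` is
    -- eventually nonzero along the sequence, which therefore eventually stays in `S`, for almost
    -- every `t`.
    · have hall : ∀ᵐ t : Vec p, ∀ n, f (x - h n • t) ≠ 0 → x - h n • t ∈ S :=
        ae_all_iff.2 fun n => ae_sub_smul (hpos n).ne' x hfS
      filter_upwards [hall] with t ht
      have hto : Tendsto (fun n => x - h n • t) atTop (𝓝 x) := by
        simpa using (tendsto_const_nhds (x := x)).sub (hzero.smul_const t)
      have hfto : Tendsto (fun n => f (x - h n • t)) atTop (𝓝 (f x)) := (hf.tendsto x).comp hto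
      have hmem : ∀ᶠ n in atTop, x - h n • t ∈ S :=
        (hfto.eventually_ne hx0).mono fun n hn => ht n hn
      have hmix : Tendsto (fun n => mix κ a c x (x - h n • t)) atTop (𝓝 (mix κ a c x x)) :=
        (hcont x hxS x hxS).tendsto.comp (tendsto_nhdsWithin_iff.2 ⟨hto, hmem⟩)
      exact (hmix.mul hfto).const_mul _

end Mean

/-! ### The two log-likelihood contributions in the single-index model -/

section Model

variable {p d : ℕ} {κ : Kernel (Vec p) (ℝ × ℝ)} {g : ℝ → ℝ} {ψ : Vec p → Vec d} {b : Vec d}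

lemma q_mem_Ioo (hg : ∀ t, g t ∈ Set.Ioo (-1 : ℝ) 1) (x : Vec p) (b : Vec d) :
    q g ψ x b ∈ Set.Ioo (0 : ℝ) 1 := by
  have := hg (∑ k, ψ x k * b k)
  rw [q]
  exact ⟨by linarith [this.1], by linarith [this.2]⟩

open Classical in
lemma logLik_W (x y : ℝ × ℝ) (z : Vec p) :
    logLik g ψ b (W x y) z =
      if Concordant x y then Real.log (q g ψ z b) else Real.log (1 - q g ψ z b) := by
  rw [logLik, W]
  split_ifs <;> ring

/-- The log-likelihood of concordance, set to zero outside of `S`. -/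
noncomputable def logConc (g : ℝ → ℝ) (ψ : Vec p → Vec d) (S : Set (Vec p)) (b : Vec d) :
    Vec p → ℝ :=
  S.indicator fun z => Real.log (q g ψ z b)

/-- The log-likelihood of absence of concordance, set to zero outside of `S`. -/
noncomputable def logDisc (g : ℝ → ℝ) (ψ : Vec p → Vec d) (S : Set (Vec p)) (b : Vec d) :
    Vec p → ℝ :=
  S.indicator fun z => Real.log (1 - q g ψ z b)

variable {S : Set (Vec p)}

lemma logConc_nonpos (hg : ∀ t, g t ∈ Set.Ioo (-1 : ℝ) 1) (z : Vec p) :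
    logConc g ψ S b z ≤ 0 :=
  Set.indicator_nonpos (fun z _ => Real.log_nonpos (q_mem_Ioo hg z b).1.le
    (q_mem_Ioo hg z b).2.le) z

lemma logDisc_nonpos (hg : ∀ t, g t ∈ Set.Ioo (-1 : ℝ) 1) (z : Vec p) :
    logDisc g ψ S b z ≤ 0 :=
  Set.indicator_nonpos (fun z _ => Real.log_nonpos (sub_nonneg.2 (q_mem_Ioo hg z b).2.le)
    (by linarith [(q_mem_Ioo (ψ := ψ) hg z b).1])) z

/-- Continuity of `q` on `S` says nothing elsewhere; cutting off outside the measurable set `S`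
gives global measurability. -/
lemma measurable_logConc (hg : ∀ t, g t ∈ Set.Ioo (-1 : ℝ) 1) (hS : MeasurableSet S)
    (hq : ContinuousOn (fun x => q g ψ x b) S) : Measurable (logConc g ψ S b) := by
  classical
  rw [logConc, ← Set.piecewise_eq_indicator]
  exact (hq.log fun z _ => (q_mem_Ioo hg z b).1.ne').measurable_piecewise continuousOn_const hS

lemma measurable_logDisc (hg : ∀ t, g t ∈ Set.Ioo (-1 : ℝ) 1) (hS : MeasurableSet S)
    (hq : ContinuousOn (fun x => q g ψ x b) S) : Measurable (logDisc g ψ S b) := by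
  classical
  rw [logDisc, ← Set.piecewise_eq_indicator]
  exact ((continuousOn_const.sub hq).log fun z _ =>
    (sub_pos.2 (q_mem_Ioo hg z b).2).ne').measurable_piecewise continuousOn_const hS

lemma mix_log_of_mem {x : Vec p} (hx : x ∈ S) (y : Vec p) :
    mix κ (logConc g ψ S b) (logDisc g ψ S b) x y = phi κ g ψ x y b := by
  simp [mix, phi, logConc, logDisc, hx]

lemma mix_log_of_notMem {x : Vec p} (hx : x ∉ S) (y : Vec p) :
    mix κ (logConc g ψ S b) (logDisc g ψ S b) x y = 0 := by
  simp [mix, logConc, logDisc, hx]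

lemma mix_indicator (a c : Vec p → ℝ) (T : Set (Vec p)) (x y : Vec p) :
    mix κ (T.indicator a) (T.indicator c) x y = T.indicator (fun x => mix κ a c x y) x := by
  by_cases hx : x ∈ T <;> simp [mix, hx]

/-- The cutoff outside `S` is invisible to observations located in `S`. -/
lemma Ln_eq_uStat {K : Vec p → ℝ} {h : ℝ} {z : ℕ → Vec p} {x : ℕ → ℝ × ℝ} (hz : ∀ i, z i ∈ S)
    (n : ℕ) :
    Ln K g ψ n h z x b =
      uStat n (pairKer K h (logConc g ψ S b) (logDisc g ψ S b)) fun i => (z i, x i) := by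
  classical
  have hoff : (Finset.range n).offDiag =
      (Finset.range n ×ˢ Finset.range n).filter fun a => a.1 ≠ a.2 := by
    ext a
    simp [Finset.mem_offDiag, and_assoc]
  rw [Ln, uStat, hoff, Finset.sum_filter, Finset.sum_product]
  congr 1
  refine Finset.sum_congr rfl fun i _ => ?_
  rw [Finset.sum_filter]
  refine Finset.sum_congr rfl fun j _ => ?_
  simp only [pairKer, logConc, logDisc, Set.indicator_of_mem (hz i), logLik_W]

end Model

/-! ### An integrable envelope, uniform in the bandwidth -/

section Envelope

variable {p d : ℕ} {κ : Kernel (Vec p) (ℝ × ℝ)} [IsMarkovKernel κ] {g : ℝ → ℝ}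
  {ψ : Vec p → Vec d} {b : Vec d} {S : Set (Vec p)} {f : Vec p → ℝ} {K : Vec p → ℝ}

lemma enorm_le_locSup {α : Type*} [PseudoMetricSpace α] {S : Set α} {ε : ℝ} {F : α → ℝ} {x t : α}
    (ht : t ∈ S) (hd : dist x t < ε) : ‖F t‖ₑ ≤ locSup S ε F x := by
  rw [← ofReal_norm, Real.norm_eq_abs]
  exact le_iSup₂_of_le (f := fun t (_ : t ∈ {t | t ∈ S ∧ dist x t < ε}) => ENNReal.ofReal |F t|)
    t ⟨ht, hd⟩ le_rfl

/-- An integrable function that dominates the conditional mean, given `Z₁ = x`, of the summands of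
the criterion, uniformly in the bandwidth, as well as the integrand of the limit criterion. -/
lemma exists_envelope {m : ℕ} (hK : IsKernelOfOrder K m) {R : ℝ} (hR : ∀ t, K t ≠ 0 → ‖t‖ ≤ R)
    (hf0 : ∀ z, 0 ≤ f z) (hf : Measurable f) (hfS : ∀ᵐ z, f z ≠ 0 → z ∈ S)
    (hg : ∀ t, g t ∈ Set.Ioo (-1 : ℝ) 1) (hS : MeasurableSet S)
    (hq : ContinuousOn (fun x => q g ψ x b) S) {ε : ℝ} (hε : 0 < ε)
    (hint : IntegrabilityTwo κ g ψ S f b ε) :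
    ∃ Ψ : Vec p → ℝ≥0∞, Measurable Ψ ∧ ∫⁻ x, Ψ x ≠ ∞ ∧
      (∀ᵐ x, ‖mix κ (logConc g ψ S b) (logDisc g ψ S b) x x‖ₑ * ENNReal.ofReal (f x) ^ 2 ≤ Ψ x) ∧
      ∀ h : ℝ, 0 < h → h * R < ε → ∀ᵐ x, ENNReal.ofReal (f x) *
        ∫⁻ y, ‖scaled K h (x - y)‖ₑ * ‖mix κ (logConc g ψ S b) (logDisc g ψ S b) x y‖ₑ
          ∂(volume.withDensity fun z => ENNReal.ofReal (f z)) ≤ Ψ x := by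
  have hmm := measurable_mix (κ := κ) (measurable_logConc hg hS hq) (measurable_logDisc hg hS hq)
  set N : ℝ≥0∞ := ∫⁻ t, ‖K t‖ₑ with hN
  have hNtop : N ≠ ∞ := hK.integrable.2.ne
  -- The factor `N` serves the smoothed integrals and the `1` serves the diagonal. Local suprema
  -- need not be measurable, so `Φ` is replaced by a measurable minorant that still dominates both
  -- families almost everywhere.
  set Φ : Vec p → ℝ≥0∞ := fun x => (N + 1) * (locSup S ε (fun y => phi κ g ψ x y b) x *
    locSup Set.univ ε f x * ENNReal.ofReal (f x)) with hΦ
  have hΦint : ∫⁻ x, Φ x ≠ ∞ := by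
    rw [hΦ, lintegral_const_mul' _ _ (by finiteness)]
    refine ENNReal.mul_ne_top (by finiteness) (ne_top_of_le_ne_top hint.ne ?_)
    refine lintegral_mono fun x => ?_
    gcongr
    rw [add_assoc]
    exact le_self_add
  obtain ⟨Ψ, hΨm, hΨ, hdom⟩ := exists_measurable_forall_le_ae hΦint
  refine ⟨Ψ, hΨm, hΨ, hdom _ ?_ fun x => ?_, fun h hh hhR => hdom _ ?_ fun x => ?_⟩
  · have := hmm.comp (f := fun x : Vec p => (x, x)) (by fun_prop)
    exact this.enorm.mul (by fun_prop)
  · by_cases hx : x ∈ S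
    · have h1 : ‖phi κ g ψ x x b‖ₑ ≤ locSup S ε (fun y => phi κ g ψ x y b) x :=
        enorm_le_locSup (F := fun y => phi κ g ψ x y b) hx (by simpa using hε)
      have h2 : ENNReal.ofReal (f x) ≤ locSup Set.univ ε f x := by
        rw [← Real.enorm_of_nonneg (hf0 x)]
        exact enorm_le_locSup (Set.mem_univ x) (by simpa using hε)
      rw [mix_log_of_mem hx, pow_two, ← mul_assoc]
      calc _ ≤ 1 * (locSup S ε (fun y => phi κ g ψ x y b) x * locSup Set.univ ε f x *
            ENNReal.ofReal (f x)) := by rw [one_mul]; gcongr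
        _ ≤ Φ x := by
          simp only [hΦ]
          gcongr
          exact le_add_self
    · simp [mix_log_of_notMem hx]
  · have hs := measurable_scaled hK.measurable h
    refine Measurable.mul (by fun_prop) (Measurable.lintegral_prod_right' (f := fun v : Vec p × Vec p =>
      ‖scaled K h (v.1 - v.2)‖ₑ * ‖mix κ (logConc g ψ S b) (logDisc g ψ S b) v.1 v.2‖ₑ) ?_)
    exact Measurable.mul (by fun_prop) hmm.enorm
  · have hs := measurable_scaled hK.measurable h
    by_cases hx : x ∈ S
    · simp only [mix_log_of_mem hx]
      have hphi : Measurable fun y => phi κ g ψ x y b := by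
        have := hmm.comp (f := fun y : Vec p => (x, y)) (by fun_prop)
        simpa only [Function.comp_def, mix_log_of_mem hx] using this
      rw [lintegral_withDensity_eq_lintegral_mul _ (by fun_prop) (by fun_prop)]
      -- Only `y` with nonzero density and nonzero kernel weight matter: almost all of them lie in
      -- `S` and within `ε` of `x`, where the local suprema apply.
      have h1 : ∀ᵐ y, ((fun z => ENNReal.ofReal (f z)) * fun y => ‖scaled K h (x - y)‖ₑ *
          ‖phi κ g ψ x y b‖ₑ) y ≤ ‖scaled K h (x - y)‖ₑ *
          (locSup S ε (fun y => phi κ g ψ x y b) x * locSup Set.univ ε f x) := by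
        filter_upwards [hfS] with y hy
        simp only [Pi.mul_apply]
        rcases eq_or_ne (f y) 0 with h0 | h0
        · simp [h0]
        rcases eq_or_ne (scaled K h (x - y)) 0 with h2 | h2
        · simp [h2]
        have hd : dist x y < ε := by
          rw [dist_eq_norm]
          exact (scaled_ne_zero_norm_le hR hh h2).trans_lt hhR
        have h3 : ‖phi κ g ψ x y b‖ₑ ≤ locSup S ε (fun y => phi κ g ψ x y b) x :=
          enorm_le_locSup (F := fun y => phi κ g ψ x y b) (hy h0) hd
        have h4 : ENNReal.ofReal (f y) ≤ locSup Set.univ ε f x := by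
          rw [← Real.enorm_of_nonneg (hf0 y)]
          exact enorm_le_locSup (Set.mem_univ y) hd
        rw [mul_comm, mul_assoc]
        gcongr
      calc _ ≤ ENNReal.ofReal (f x) * ∫⁻ y, ‖scaled K h (x - y)‖ₑ *
            (locSup S ε (fun y => phi κ g ψ x y b) x * locSup Set.univ ε f x) :=
            mul_le_mul' le_rfl (lintegral_mono_ae h1)
        _ = ENNReal.ofReal (f x) * (N *
            (locSup S ε (fun y => phi κ g ψ x y b) x * locSup Set.univ ε f x)) := by
            rw [lintegral_mul_const _ (by fun_prop),
              lintegral_sub_left_eq_self (fun z => ‖scaled K h z‖ₑ) x,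
              lintegral_enorm_scaled hK.measurable hh]
        _ = N * (locSup S ε (fun y => phi κ g ψ x y b) x * locSup Set.univ ε f x *
            ENNReal.ofReal (f x)) := by ring
        _ ≤ Φ x := by
            simp only [hΦ]
            gcongr
            exact le_self_add
    · simp [mix_log_of_notMem hx]

/-- The integral that defines the limit criterion converges absolutely. -/
lemma integrable_phi_mul_sq {m : ℕ} (hK : IsKernelOfOrder K m)
    (hf0 : ∀ z, 0 ≤ f z) (hf : Measurable f) (hfS : ∀ᵐ z, f z ≠ 0 → z ∈ S)
    (hg : ∀ t, g t ∈ Set.Ioo (-1 : ℝ) 1) (hS : MeasurableSet S)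
    (hq : ContinuousOn (fun x => q g ψ x b) S) {ε : ℝ} (hε : 0 < ε)
    (hint : IntegrabilityTwo κ g ψ S f b ε) :
    Integrable (fun z => phi κ g ψ z z b * f z ^ 2) := by
  obtain ⟨R, hR⟩ := hK.compactSupport.isCompact.isBounded.exists_norm_le
  obtain ⟨Ψ, -, hΨ, h1, -⟩ := exists_envelope hK (fun t ht => hR t (subset_tsupport K ht)) hf0 hf
    hfS hg hS hq hε hint
  have hmm := measurable_mix (κ := κ) (measurable_logConc hg hS hq) (measurable_logDisc hg hS hq)
  have hmm' := hmm.comp (f := fun x : Vec p => (x, x)) (by fun_prop)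
  have hI : Integrable fun z =>
      mix κ (logConc g ψ S b) (logDisc g ψ S b) z z * f z ^ 2 := by
    refine ⟨(hmm'.mul (hf.pow_const 2)).aestronglyMeasurable, ?_⟩
    refine (lintegral_mono_ae ?_).trans_lt hΨ.lt_top
    filter_upwards [h1] with x hx
    rwa [enorm_mul, enorm_pow, Real.enorm_of_nonneg (hf0 x)]
  refine hI.congr ?_
  filter_upwards [hfS] with z hz
  rcases eq_or_ne (f z) 0 with h0 | h0
  · simp [h0]
  · rw [mix_log_of_mem (hz h0)]

end Envelope

/-! ### Truncation and the pointwise limit of the criterion -/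

section PointwiseLimit

variable {p d : ℕ} {κ : Kernel (Vec p) (ℝ × ℝ)} [IsMarkovKernel κ] {g : ℝ → ℝ}
  {ψ : Vec p → Vec d} {b : Vec d} {S : Set (Vec p)} {f : Vec p → ℝ} {K : Vec p → ℝ}

/-- The region where `a` and `c` are bounded by `k` and the argument has norm at most `k`. -/
def truncSet (a c : Vec p → ℝ) (k : ℕ) : Set (Vec p) :=
  {x | ‖x‖ ≤ k ∧ |a x| ≤ k ∧ |c x| ≤ k}

lemma measurableSet_truncSet {a c : Vec p → ℝ} (ha : Measurable a) (hc : Measurable c) (k : ℕ) :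
    MeasurableSet (truncSet a c k) :=
  (measurableSet_le measurable_norm measurable_const).inter
    ((measurableSet_le ha.abs measurable_const).inter (measurableSet_le hc.abs measurable_const))

lemma monotone_truncSet (a c : Vec p → ℝ) : Monotone (truncSet a c) := by
  intro i j hij x hx
  have : (i : ℝ) ≤ j := by exact_mod_cast hij
  exact ⟨hx.1.trans this, hx.2.1.trans this, hx.2.2.trans this⟩

lemma iUnion_truncSet (a c : Vec p → ℝ) : ⋃ k, truncSet a c k = Set.univ := by
  refine Set.eq_univ_of_forall fun x => Set.mem_iUnion.2 ?_
  obtain ⟨k, hk⟩ := exists_nat_ge (max ‖x‖ (max |a x| |c x|))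
  exact ⟨k, (le_max_left _ _).trans hk, ((le_max_left _ _).trans (le_max_right _ _)).trans hk,
    ((le_max_right _ _).trans (le_max_right _ _)).trans hk⟩

/-- The truncation sets increase to the whole space, so the finite measure with density `Ψ` of their
complements tends to zero. -/
lemma exists_setLIntegral_compl_truncSet_le {a c : Vec p → ℝ} (ha : Measurable a)
    (hc : Measurable c) {Ψ : Vec p → ℝ≥0∞} (hΨ : ∫⁻ x, Ψ x ≠ ∞) {δ : ℝ} (hδ : 0 < δ) :
    ∃ k, ∫⁻ x in (truncSet a c k)ᶜ, Ψ x ≤ ENNReal.ofReal δ := by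
  have h1 : Tendsto (fun k => ∫⁻ x in (truncSet a c k)ᶜ, Ψ x) atTop (𝓝 0) := by
    have hm : ∀ k, MeasurableSet (truncSet a c k)ᶜ := fun k => (measurableSet_truncSet ha hc k).compl
    have h2 : Tendsto (fun k => (volume.withDensity Ψ) (truncSet a c k)ᶜ) atTop
        (𝓝 ((volume.withDensity Ψ) (⋂ k, (truncSet a c k)ᶜ))) :=
      tendsto_measure_iInter_atTop (fun k => (hm k).nullMeasurableSet)
        (fun i j hij => Set.compl_subset_compl.2 (monotone_truncSet a c hij))
        ⟨0, by
          rw [withDensity_apply _ (hm 0)]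
          exact ne_top_of_le_ne_top hΨ (setLIntegral_le_lintegral _ _)⟩
    rw [← Set.compl_iUnion, iUnion_truncSet, Set.compl_univ, measure_empty] at h2
    simpa only [withDensity_apply _ (hm _)] using h2
  exact ((ENNReal.tendsto_nhds_zero.1 h1) _ (ENNReal.ofReal_pos.2 hδ)).exists

variable {Ω : Type*} [MeasurableSpace Ω] {P : Measure Ω} [IsProbabilityMeasure P]

/-- For every `β`, the criterion `L_n(β)` converges in probability to `L_∞(β)`. -/
theorem tendstoInMeasure_Ln {Z : ℕ → Ω → Vec p} {X : ℕ → Ω → ℝ × ℝ}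
    (hZ : ∀ i, Measurable (Z i)) (hX : ∀ i, Measurable (X i))
    (hindep : iIndepFun (fun i ω => (Z i ω, X i ω)) P)
    (hf0 : ∀ z, 0 ≤ f z) (hf : Continuous f)
    [IsProbabilityMeasure (volume.withDensity fun z => ENNReal.ofReal (f z))]
    (hlaw : ∀ i, P.map (fun ω => (Z i ω, X i ω)) =
      (volume.withDensity fun z => ENNReal.ofReal (f z)) ⊗ₘ κ)
    (hS : MeasurableSet S) (hZS : ∀ i, ∀ᵐ ω ∂P, Z i ω ∈ S) (hfS : ∀ᵐ z, f z ≠ 0 → z ∈ S)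
    (hg : ∀ t, g t ∈ Set.Ioo (-1 : ℝ) 1) {m : ℕ} (hK : IsKernelOfOrder K m)
    {h : ℕ → ℝ} (hpos : ∀ n, 0 < h n) (hzero : Tendsto h atTop (𝓝 0))
    (hrate : Tendsto (fun n : ℕ => (n : ℝ) ^ 2 * h n ^ p) atTop atTop)
    (hphi : ∀ x ∈ S, ContinuousOn (fun y => phi κ g ψ x y b) S)
    (hq : ContinuousOn (fun x => q g ψ x b) S) {ε : ℝ} (hε : 0 < ε)
    (hint : IntegrabilityTwo κ g ψ S f b ε) :
    TendstoInMeasure P (fun n ω => Ln K g ψ n (h n) (fun i => Z i ω) (fun i => X i ω) b) atTop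
      (fun _ => Linf κ g ψ f b) := by
  obtain ⟨R, hR'⟩ := hK.compactSupport.isCompact.isBounded.exists_norm_le
  have hR : ∀ t, K t ≠ 0 → ‖t‖ ≤ R := fun t ht => hR' t (subset_tsupport K ht)
  set a := logConc g ψ S b with ha_def
  set c := logDisc g ψ S b with hc_def
  have ha : Measurable a := measurable_logConc hg hS hq
  have hc : Measurable c := measurable_logDisc hg hS hq
  have ha0 : ∀ x, a x ≤ 0 := logConc_nonpos hg
  have hc0 : ∀ x, c x ≤ 0 := logDisc_nonpos hg
  have hfm := hf.measurable
  have hmm := measurable_mix (κ := κ) ha hc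
  have hmd : Measurable fun x => mix κ a c x x :=
    hmm.comp (f := fun x : Vec p => (x, x)) (by fun_prop)
  obtain ⟨Ψ, hΨm, hΨ, hdiag, hker⟩ := exists_envelope hK hR hf0 hfm hfS hg hS hq hε hint
  rw [← ha_def, ← hc_def] at hdiag hker
  have hLinf : Linf κ g ψ f b = ∫ x, mix κ a c x x * f x ^ 2 := by
    refine integral_congr_ae ?_
    filter_upwards [hfS] with z hz
    rcases eq_or_ne (f z) 0 with h0 | h0
    · simp [h0]
    · rw [ha_def, hc_def, mix_log_of_mem (hz h0)]
  have hfin : ∫⁻ x, ‖mix κ a c x x * f x ^ 2‖ₑ ≤ ∫⁻ x, Ψ x := by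
    refine lintegral_mono_ae ?_
    filter_upwards [hdiag] with x hx
    rwa [enorm_mul, enorm_pow, Real.enorm_of_nonneg (hf0 x)]
  have hLint : Integrable fun x => mix κ a c x x * f x ^ 2 :=
    ⟨(hmd.mul (hfm.pow_const 2)).aestronglyMeasurable, hfin.trans_lt hΨ.lt_top⟩
  have hU : TendstoInMeasure P (fun n ω => uStat n (pairKer K (h n) a c)
      (fun i => (Z i ω, X i ω))) atTop (fun _ => Linf κ g ψ f b) := by
    refine tendstoInMeasure_uStat (fun i => (hZ i).prodMk (hX i)) hindep hlaw
      (fun n => measurable_pairKer hK.measurable ha hc) fun δ hδ => ?_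
    -- A single truncation level serves twice: for the L¹ error at all small bandwidths and for the
    -- error in the limit.
    obtain ⟨k, hk⟩ := exists_setLIntegral_compl_truncSet_le ha hc hΨ hδ
    set T := truncSet a c k with hT
    have hTm : MeasurableSet T := measurableSet_truncSet ha hc k
    obtain ⟨M', hM'⟩ := (isCompact_closedBall (0 : Vec p) (k + 1)).exists_bound_of_continuousOn
      hf.continuousOn
    set M := max M' 0
    have hM : ∀ z, ‖z‖ ≤ (k : ℝ) + 1 → f z ≤ M := fun z hz =>
      ((le_abs_self _).trans (hM' z (by simpa using hz))).trans (le_max_left _ _)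
    have hM0 : 0 ≤ M := le_max_right _ _
    have hat : Measurable (T.indicator a) := ha.indicator hTm
    have hct : Measurable (T.indicator c) := hc.indicator hTm
    have hab : ∀ x, |T.indicator a x| ≤ k := fun x => by
      by_cases hx : x ∈ T
      · rw [Set.indicator_of_mem hx]; exact hx.2.1
      · simp [Set.indicator_of_notMem hx]
    have hcb : ∀ x, |T.indicator c x| ≤ k := fun x => by
      by_cases hx : x ∈ T
      · rw [Set.indicator_of_mem hx]; exact hx.2.2
      · simp [Set.indicator_of_notMem hx]
    have hout : ∀ x : Vec p, (k : ℝ) < ‖x‖ → x ∉ T := fun x hx hxT => hx.not_ge hxT.1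
    have har : ∀ x, (k : ℝ) < ‖x‖ → T.indicator a x = 0 := fun x hx =>
      Set.indicator_of_notMem (hout x hx) _
    have hcr : ∀ x, (k : ℝ) < ‖x‖ → T.indicator c x = 0 := fun x hx =>
      Set.indicator_of_notMem (hout x hx) _
    set N₁ := (∫⁻ t, ‖K t‖ₑ).toReal with hN₁
    have hN₁' : ENNReal.ofReal N₁ = ∫⁻ t, ‖K t‖ₑ := ENNReal.ofReal_toReal hK.integrable.2.ne
    set N₂ := (∫⁻ t, ‖K t‖ₑ ^ 2).toReal with hN₂
    have hN₂' : ENNReal.ofReal N₂ = ∫⁻ t, ‖K t‖ₑ ^ 2 := by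
      refine ENNReal.ofReal_toReal ?_
      have := hK.sq_integrable.2.ne
      simpa only [enorm_pow] using this
    have hC : ENNReal.ofReal ((k : ℝ) * (M * N₁)) =
        ENNReal.ofReal k * (ENNReal.ofReal M * ∫⁻ t, ‖K t‖ₑ) := by
      rw [ENNReal.ofReal_mul (by positivity), ENNReal.ofReal_mul hM0, hN₁']
    have hhR : ∀ r > 0, ∀ᶠ n in atTop, h n * R < r := fun r hr => by
      have : Tendsto (fun n => h n * R) atTop (𝓝 0) := by simpa using hzero.mul_const R
      exact this.eventually (gt_mem_nhds hr)
    have hsq : ∀ n, h n * R ≤ 1 → ∫⁻ u, ‖pairKer K (h n) (T.indicator a) (T.indicator c) u‖ₑ ^ 2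
        ∂(((volume.withDensity fun z => ENNReal.ofReal (f z)) ⊗ₘ κ).prod
          ((volume.withDensity fun z => ENNReal.ofReal (f z)) ⊗ₘ κ)) ≤
        ENNReal.ofReal ((k : ℝ) ^ 2 * (M * ((h n ^ p)⁻¹ * N₂))) := by
      intro n hn
      have hp : 0 < h n ^ p := pow_pos (hpos n) p
      rw [ENNReal.ofReal_mul (by positivity), ENNReal.ofReal_mul hM0,
        ENNReal.ofReal_mul (by positivity), hN₂', ENNReal.ofReal_pow (by positivity)]
      exact lintegral_enorm_pairKer_sq_le hK.measurable hfm (hpos n) hR hn hM hab hcb hat hct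
        har hcr
    refine ⟨fun n => pairKer K (h n) (T.indicator a) (T.indicator c), (k : ℝ) * (M * N₁),
      fun n => (k : ℝ) ^ 2 * (M * ((h n ^ p)⁻¹ * N₂)),
      ∫ x, mix κ (T.indicator a) (T.indicator c) x x * f x
        ∂(volume.withDensity fun z => ENNReal.ofReal (f z)),
      fun n => measurable_pairKer hK.measurable hat hct, by positivity, fun n => ?_, ?_, ?_, ?_, ?_⟩
    · have hp : 0 < h n ^ p := pow_pos (hpos n) p
      positivity
    -- Divided by `n ^ 2`, the second-moment bound is a constant over `n² h^p`.
    · have h1 : Tendsto (fun n : ℕ => (k : ℝ) ^ 2 * (M * N₂) / ((n : ℝ) ^ 2 * h n ^ p)) atTop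
          (𝓝 0) := hrate.const_div_atTop _
      refine h1.congr fun n => ?_
      simp only [div_eq_mul_inv, mul_inv]
      ring
    · filter_upwards [hhR 1 one_pos, hhR ε hε] with n hn1 hnε
      refine ⟨fun y => ?_, fun y' => ?_, hsq n hn1.le, ?_⟩
      · rw [hC]
        exact lintegral_enorm_pairKer_right_le hK.measurable hfm (hpos n) hR hn1.le hM hab hcb
          har hcr y
      · rw [hC]
        exact lintegral_enorm_pairKer_left_le hK.measurable hfm (hpos n)
          (fun z hz => hM z (by linarith)) hab hcb har hcr y'
      -- The error is again a pair kernel with nonpositive contributions, living on the complement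
      -- of `T`, so the conditional-mean identity and the envelope apply to it.
      · have hdiff : ∀ u, pairKer K (h n) a c u - pairKer K (h n) (T.indicator a) (T.indicator c) u =
            pairKer K (h n) (Tᶜ.indicator a) (Tᶜ.indicator c) u := fun u => by
          by_cases hu : u.1.1 ∈ T <;> simp [pairKer, hu]
        simp only [hdiff]
        rw [lintegral_enorm_pairKer _ hK.measurable (ha.indicator hTm.compl)
          (hc.indicator hTm.compl) (Set.indicator_nonpos fun x _ => ha0 x)
          (Set.indicator_nonpos fun x _ => hc0 x)]
        have hinner : ∀ x, ∫⁻ y, ‖scaled K (h n) (x - y)‖ₑ *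
            ‖mix κ (Tᶜ.indicator a) (Tᶜ.indicator c) x y‖ₑ
              ∂(volume.withDensity fun z => ENNReal.ofReal (f z)) =
            Tᶜ.indicator (fun x => ∫⁻ y, ‖scaled K (h n) (x - y)‖ₑ * ‖mix κ a c x y‖ₑ
              ∂(volume.withDensity fun z => ENNReal.ofReal (f z))) x := fun x => by
          by_cases hx : x ∈ Tᶜ
          · simp only [mix_indicator, Set.indicator_of_mem hx]
          · simp only [mix_indicator, Set.indicator_of_notMem hx]
            simp
        simp only [hinner]
        have hs := measurable_scaled hK.measurable (h n)
        have hmeas : Measurable fun x => ∫⁻ y, ‖scaled K (h n) (x - y)‖ₑ * ‖mix κ a c x y‖ₑ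
            ∂(volume.withDensity fun z => ENNReal.ofReal (f z)) :=
          Measurable.lintegral_prod_right' (f := fun v : Vec p × Vec p =>
            ‖scaled K (h n) (v.1 - v.2)‖ₑ * ‖mix κ a c v.1 v.2‖ₑ)
            (Measurable.mul (by fun_prop) hmm.enorm)
        rw [lintegral_indicator hTm.compl, setLIntegral_withDensity_eq_setLIntegral_mul _
          (by fun_prop) hmeas hTm.compl]
        exact (lintegral_mono_ae (ae_restrict_of_ae (hker (h n) (hpos n) hnε))).trans hk
    · have hmean := tendsto_integral_scaled_mul_mix (κ := κ) hK hR hf0 hf hfS hpos hzero hM hab hcb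
        hat hct har hcr fun x hx => by
          by_cases hxT : x ∈ T
          · have : mix κ (T.indicator a) (T.indicator c) x = fun y => phi κ g ψ x y b := by
              funext y
              rw [mix_indicator, Set.indicator_of_mem hxT, ha_def, hc_def, mix_log_of_mem hx]
            rw [this]
            exact hphi x hx
          · have : mix κ (T.indicator a) (T.indicator c) x = fun _ => 0 := by
              funext y
              rw [mix_indicator, Set.indicator_of_notMem hxT]
            rw [this]
            exact continuousOn_const
      refine hmean.congr' ?_
      filter_upwards [hhR 1 one_pos] with n hn
      refine (integral_pairKer _ hK.measurable hat hct ?_).symm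
      have hm := measurable_pairKer (h := h n) hK.measurable hat hct
      refine MemLp.integrable (q := 2) one_le_two ⟨hm.aestronglyMeasurable, ?_⟩
      rw [eLpNorm_lt_top_iff_lintegral_rpow_enorm_lt_top (by norm_num) (by norm_num)]
      have : ((2 : ℝ≥0∞).toReal) = ((2 : ℕ) : ℝ) := by simp
      simp only [this, ENNReal.rpow_natCast]
      exact (hsq n hn.le).trans_lt ENNReal.ofReal_lt_top
    · have h1 : ∫ x, mix κ (T.indicator a) (T.indicator c) x x * f x
          ∂(volume.withDensity fun z => ENNReal.ofReal (f z)) =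
          ∫ x in T, mix κ a c x x * f x ^ 2 := by
        rw [integral_withDensity_eq_integral_toReal_smul (by fun_prop)
          (ae_of_all _ fun _ => ENNReal.ofReal_lt_top), ← integral_indicator hTm]
        refine integral_congr_ae (ae_of_all _ fun x => ?_)
        simp only [mix_indicator, ENNReal.toReal_ofReal (hf0 x), smul_eq_mul]
        by_cases hx : x ∈ T
        · simp only [Set.indicator_of_mem hx]
          ring
        · simp [Set.indicator_of_notMem hx]
      rw [h1, hLinf, ← integral_add_compl hTm hLint, sub_add_cancel_left, abs_neg,
        ← Real.norm_eq_abs]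
      refine (norm_integral_le_lintegral_norm _).trans (ENNReal.toReal_le_of_le_ofReal hδ.le ?_)
      refine le_trans (lintegral_mono_ae (ae_restrict_of_ae ?_)) hk
      filter_upwards [hdiag] with x hx
      rwa [ofReal_norm, enorm_mul, enorm_pow, Real.enorm_of_nonneg (hf0 x)]
  refine hU.congr_left fun n => ?_
  filter_upwards [ae_all_iff.2 hZS] with ω hω
  exact (Ln_eq_uStat hω n).symm

end PointwiseLimit

/-! ### Identification of the true parameter -/

section Identification

variable {p d : ℕ} {κ : Kernel (Vec p) (ℝ × ℝ)} [IsMarkovKernel κ] {g : ℝ → ℝ}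
  {ψ : Vec p → Vec d} {S : Set (Vec p)} {f : Vec p → ℝ}

/-- Independent copies of an absolutely continuous variable are almost surely not tied. -/
lemma prod_ties_eq_zero {μ : Measure (ℝ × ℝ)} [IsProbabilityMeasure μ] (hμ : μ ≪ volume) :
    (μ.prod μ) {u | (u.2.1 - u.1.1) * (u.2.2 - u.1.2) = 0} = 0 := by
  rw [Measure.measure_prod_null (measurableSet_eq_fun (by fun_prop) (by fun_prop))]
  refine ae_of_all _ fun x => ?_
  refine hμ (measure_mono_null (t := ({x.1} ×ˢ Set.univ) ∪ (Set.univ ×ˢ {x.2})) ?_ ?_)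
  · intro y hy
    rcases mul_eq_zero.1 (show (y.1 - x.1) * (y.2 - x.2) = 0 from hy) with h | h
    · exact Or.inl ⟨sub_eq_zero.1 h, trivial⟩
    · exact Or.inr ⟨trivial, sub_eq_zero.1 h⟩
  · rw [measure_union_null_iff, Measure.volume_eq_prod, Measure.prod_prod, Measure.prod_prod]
    simp

/-- Without ties, discordance is the complement of concordance up to a null set. -/
lemma condTau_eq {z : Vec p} (hz : κ z ≪ volume) : condTau κ z = 2 * prob2 κ z z - 1 := by
  have hcompl : ((κ z).prod (κ z)).real {u | Discordant u.1 u.2} =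
      ((κ z).prod (κ z)).real {u | Concordant u.1 u.2}ᶜ := by
    refine measureReal_congr ?_
    have hties : ∀ᵐ u ∂((κ z).prod (κ z)), ¬ (u.2.1 - u.1.1) * (u.2.2 - u.1.2) = 0 := by
      rw [ae_iff]
      simpa only [not_not] using prod_ties_eq_zero hz
    filter_upwards [hties] with u hu
    refine propext ?_
    change (u.2.1 - u.1.1) * (u.2.2 - u.1.2) < 0 ↔ ¬ 0 < (u.2.1 - u.1.1) * (u.2.2 - u.1.2)
    rw [not_lt]
    exact ⟨le_of_lt, fun h => lt_of_le_of_ne h hu⟩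
  rw [condTau, hcompl, probReal_compl_eq_one_sub measurableSet_concordant, prob2]
  ring

/-- Gibbs' inequality for Bernoulli laws. -/
lemma bernoulli_gibbs {s t : ℝ} (hs : s ∈ Set.Ioo (0 : ℝ) 1) (ht : t ∈ Set.Ioo (0 : ℝ) 1) :
    s * Real.log t + (1 - s) * Real.log (1 - t) ≤
      s * Real.log s + (1 - s) * Real.log (1 - s) := by
  have key : ∀ {s t : ℝ}, 0 < s → 0 < t → s * Real.log t - s * Real.log s ≤ t - s := by
    intro s t hs ht
    have h1 := Real.log_le_sub_one_of_pos (div_pos ht hs)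
    rw [Real.log_div ht.ne' hs.ne'] at h1
    have h2 := mul_le_mul_of_nonneg_left h1 hs.le
    have h3 : s * (t / s - 1) = t - s := by field_simp
    linarith
  have h1 := key hs.1 ht.1
  have h2 := key (sub_pos.2 hs.2) (sub_pos.2 ht.2)
  linarith

/-- Under the model, φ(z, z, β) is the expected log-likelihood of a Bernoulli variable of parameter
q(z, β*), so Gibbs' inequality applies. -/
lemma phi_le_phi_of_model (hg : ∀ t, g t ∈ Set.Ioo (-1 : ℝ) 1) {z : Vec p} (hz : κ z ≪ volume)
    {βstar : Vec d} (hmodel : condTau κ z = g (∑ k, ψ z k * βstar k)) (b : Vec d) :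
    phi κ g ψ z z b ≤ phi κ g ψ z z βstar := by
  have hprob : prob2 κ z z = q g ψ z βstar := by
    rw [condTau_eq hz] at hmodel
    rw [q]
    linarith
  rw [phi, phi, hprob]
  exact bernoulli_gibbs (q_mem_Ioo hg z βstar) (q_mem_Ioo hg z b)

lemma convexOn_l1 : ConvexOn ℝ Set.univ (l1 : Vec d → ℝ) := by
  refine ⟨convex_univ, fun x _ y _ s t hs ht _ => ?_⟩
  simp only [l1, smul_eq_mul, Finset.mul_sum, ← Finset.sum_add_distrib]
  refine Finset.sum_le_sum fun k _ => ?_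
  simp only [PiLp.add_apply, PiLp.smul_apply, smul_eq_mul]
  refine (abs_add_le _ _).trans ?_
  rw [abs_mul, abs_mul, abs_of_nonneg hs, abs_of_nonneg ht]

end Identification

lemma tendstoInMeasure_sub_of_tendsto {Ω : Type*} [MeasurableSpace Ω] {P : Measure Ω}
    {U : ℕ → Ω → ℝ} {u : ℝ} (hU : TendstoInMeasure P U atTop fun _ => u) {v : ℕ → ℝ} {v₀ : ℝ}
    (hv : Tendsto v atTop (𝓝 v₀)) :
    TendstoInMeasure P (fun n ω => U n ω - v n) atTop fun _ => u - v₀ := by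
  rw [tendstoInMeasure_iff_dist] at hU ⊢
  intro ε hε
  refine tendsto_of_tendsto_of_tendsto_of_le_of_le' tendsto_const_nhds (hU (ε / 2) (by positivity))
    (Eventually.of_forall fun _ => zero_le) ?_
  filter_upwards [Metric.tendsto_nhds.1 hv (ε / 2) (by positivity)] with n hn
  refine measure_mono fun ω hω => ?_
  simp only [Set.mem_ofPred_eq] at hω ⊢
  have := dist_sub_sub_le (U n ω) (v n) u v₀
  linarith

end CKT

/-! ### Consistency of the penalized estimator -/

theorem theorem1 {Ω : Type*} [MeasurableSpace Ω] (P : Measure Ω) [IsProbabilityMeasure P]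
    {p d : ℕ}
    -- the i.i.d. sample `(Z i, X i)`
    (Z : ℕ → Ω → CKT.Vec p) (X : ℕ → Ω → ℝ × ℝ)
    (hZ : ∀ i, Measurable (Z i)) (hX : ∀ i, Measurable (X i))
    (hindep : iIndepFun (fun i ω => (Z i ω, X i ω)) P)
    -- `f` is the density of `Z` and `κ z` the conditional law of `X` given `Z = z`
    (f : CKT.Vec p → ℝ) (hf : ∀ z, 0 ≤ f z)
    (κ : Kernel (CKT.Vec p) (ℝ × ℝ)) [IsMarkovKernel κ]
    (hlaw : ∀ i, P.map (fun ω => (Z i ω, X i ω)) =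
      (volume.withDensity fun z => ENNReal.ofReal (f z)) ⊗ₘ κ)
    -- the set `S` in which `Z` takes its values
    (S : Set (CKT.Vec p)) (hS : MeasurableSet S) (hZS : ∀ i, ∀ᵐ ω ∂P, Z i ω ∈ S)
    (hκ : ∀ z ∈ S, κ z ≪ volume)
    -- the single-index model
    (g : ℝ → ℝ) (hg : ∀ t, g t ∈ Set.Ioo (-1 : ℝ) 1) (ψ : CKT.Vec p → CKT.Vec d)
    (βstar : CKT.Vec d) (hmodel : ∀ z ∈ S, CKT.condTau κ z = g (∑ k, ψ z k * βstar k))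
    -- kernel, bandwidths, penalties
    (m : ℕ) (hm : 2 ≤ m) (K : CKT.Vec p → ℝ) (hK : CKT.IsKernelOfOrder K m)
    (h : ℕ → ℝ) (hpos : ∀ n, 0 < h n) (hzero : Tendsto h atTop (𝓝 0))
    (hrate : Tendsto (fun n : ℕ => (n : ℝ) ^ 2 * h n ^ p) atTop atTop)
    (lam : ℕ → ℝ) (hlam : ∀ n, 0 ≤ lam n) (lamInf : ℝ)
    (hlamInf : Tendsto lam atTop (𝓝 lamInf))
    -- regularity and integrability
    (hreg : CKT.Regular κ g ψ S f m)
    (hint : ∀ b : CKT.Vec d, ∃ ε > 0,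
      CKT.IntegrabilityOne κ g ψ S f b ε ∧ CKT.IntegrabilityTwo κ g ψ S f b ε)
    (hconcave : ∀ n, ∀ᵐ ω ∂P, ConcaveOn ℝ Set.univ
      (CKT.Ln K g ψ n (h n) (fun i => Z i ω) (fun i => X i ω)))
    -- the estimator: a maximizer of the penalized criterion, whenever there is one
    (βhat : ℕ → Ω → CKT.Vec d)
    (hβhat : ∀ n, ∀ᵐ ω ∂P,
      (∃ b, CKT.IsArgmax (fun b => CKT.Ln K g ψ n (h n) (fun i => Z i ω) (fun i => X i ω) b
        - lam n * CKT.l1 b) b) →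
      CKT.IsArgmax (fun b => CKT.Ln K g ψ n (h n) (fun i => Z i ω) (fun i => X i ω) b
        - lam n * CKT.l1 b) (βhat n ω))
    -- the maximizer of the limit criterion
    (βlim : CKT.Vec d)
    (hβlim : CKT.IsUniqueArgmax (fun b => CKT.Linf κ g ψ f b - lamInf * CKT.l1 b) βlim) :
    (∀ b : CKT.Vec d, Integrable (fun z => CKT.phi κ g ψ z z b * f z ^ 2)) ∧
    TendstoInMeasure P βhat atTop (fun _ => βlim) ∧
    (lamInf = 0 → βlim = βstar) := by
  have hlaw0 := hlaw 0
  have hfcont : Continuous f := hreg.density.continuous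
  have hfm : Measurable f := hfcont.measurable
  have hYm : ∀ i, Measurable fun ω => (Z i ω, X i ω) := fun i => (hZ i).prodMk (hX i)
  have hμ : IsProbabilityMeasure ((volume.withDensity fun z => ENNReal.ofReal (f z)) ⊗ₘ κ) := by
    rw [← hlaw0]
    exact Measure.isProbabilityMeasure_map (hYm 0).aemeasurable
  have hν : IsProbabilityMeasure (volume.withDensity fun z => ENNReal.ofReal (f z)) := by
    rw [← Measure.fst_compProd (volume.withDensity fun z => ENNReal.ofReal (f z)) κ]
    infer_instance
  have hZlaw : P.map (Z 0) = volume.withDensity fun z => ENNReal.ofReal (f z) := by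
    rw [← Measure.fst_compProd (volume.withDensity fun z => ENNReal.ofReal (f z)) κ, ← hlaw0,
      Measure.fst_map_prodMk (hX 0)]
  -- Membership in `S`, known almost surely under the law of `Z`, becomes a statement about
  -- Lebesgue-almost every point of nonzero density.
  have hfS : ∀ᵐ z, f z ≠ 0 → z ∈ S := by
    have h1 : ∀ᵐ z ∂(P.map (Z 0)), z ∈ S := (ae_map_iff (hZ 0).aemeasurable hS).2 (hZS 0)
    rw [hZlaw, ae_withDensity_iff (by fun_prop)] at h1
    filter_upwards [h1] with z hz hfz
    exact hz (ENNReal.ofReal_pos.2 (lt_of_le_of_ne (hf z) (Ne.symm hfz))).ne'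
  have hinteg : ∀ b : CKT.Vec d, Integrable (fun z => CKT.phi κ g ψ z z b * f z ^ 2) := by
    intro b
    obtain ⟨ε, hε, -, h2⟩ := hint b
    exact CKT.integrable_phi_mul_sq hK hf hfm hfS hg hS (hreg.q_continuous b) hε h2
  refine ⟨hinteg, ?_, fun hlam0 => ?_⟩
  · have hlim : ∀ b : CKT.Vec d, TendstoInMeasure P (fun n ω =>
        CKT.Ln K g ψ n (h n) (fun i => Z i ω) (fun i => X i ω) b - lam n * CKT.l1 b) atTop
        (fun _ => CKT.Linf κ g ψ f b - lamInf * CKT.l1 b) := by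
      intro b
      obtain ⟨ε, hε, -, h2⟩ := hint b
      exact CKT.tendstoInMeasure_sub_of_tendsto
        (CKT.tendstoInMeasure_Ln hZ hX hindep hf hfcont hlaw hS hZS hfS hg hK hpos hzero hrate
          (fun x hx => hreg.phi_continuous x hx b) (hreg.q_continuous b) hε h2)
        (hlamInf.mul_const _)
    refine CKT.tendstoInMeasure_argmax_of_concave hlim (fun n => ?_) hβhat hβlim
    filter_upwards [hconcave n] with ω hω
    exact hω.sub (CKT.convexOn_l1.smul (hlam n))
  · by_contra hne
    have h1 := hβlim βstar (Ne.symm hne)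
    simp only [hlam0, zero_mul, sub_zero] at h1
    refine h1.not_ge (integral_mono_ae (hinteg βlim) (hinteg βstar) ?_)
    filter_upwards [hfS] with z hz
    rcases eq_or_ne (f z) 0 with h0 | h0
    · simp [h0]
    · exact mul_le_mul_of_nonneg_right
        (CKT.phi_le_phi_of_model hg (hκ z (hz h0)) (hmodel z (hz h0)) βlim) (sq_nonneg _)
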